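/- **Theorem 1 (Contraction).** Let $A,B$ be finite-dimensional complex Hilbert spaces, $\alpha\in(1,2]$, and let $\rho_{AB}$ be a quantum state (positive semidefinite operator of trace one) on $A\otimes B$ with marginals $\rho_A=\operatorname{tr}_B[\rho_{AB}]$, $\rho_B=\operatorname{tr}_A[\rho_{AB}]$. Real powers of positive semidefinite operators are taken on the support (the orthogonal complement of the kernel), and $X\sim Y$ means that $X$ and $Y$ have the same support. For states $\sigma_A$ on $A$ with $\ker\sigma_A\subseteq\ker\rho_A$ and states $\tau_B$ on $B$ with $\ker\tau_B\subseteq\ker\rho_B$ let $$\mathcal N_{A\to B}(\sigma_A)=\frac{(\operatorname{tr}_A[\rho_{AB}^\alpha(\sigma_A^{1-\alpha}\otimes 1_B)])^{1/\alpha}}{\operatorname{tr}[(\operatorname{tr}_A[\rho_{AB}^\alpha(\sigma_A^{1-\alpha}\otimes 1_B)])^{1/\alpha}]},\qquad \mathcal N_{B\to A}(\tau_B)=\frac{(\operatorname{tr}_B[\rho_{AB}^\alpha(1_A\otimes\tau_B^{1-\alpha})])^{1/\alpha}}{\operatorname{tr}[(\operatorname{tr}_B[\rho_{AB}^\alpha(1_A\otimes\tau_B^{1-\alpha})])^{1/\alpha}]}.$$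 These are well-defined maps into the states $\sim\rho_B$ and the states $\sim\rho_A$, respectively. For positive semidefinite $X,Y$ let $M(X/Y)=\inf\{\beta\in\mathbb R: X\le\beta Y\}$, and let Hilbert's projective metric be $d_H(X,Y)=\log\big(M(X/Y)M(Y/X)\big)$ if $X\sim Y\ne0$, $d_H(0,0)=0$, and $d_H(X,Y)=\infty$ otherwise. Let $\gamma=|1-\tfrac1\alpha|$. (a) For all states $\sigma_A,\tilde\sigma_A\sim\rho_A$ on $A$ and all states $\tau_B,\tilde\tau_B\sim\rho_B$ on $B$, $$d_H(\mathcal N_{A\to B}(\sigma_A),\mathcal N_{A\to B}(\tilde\sigma_A))\le\gamma\, d_H(\sigma_A,\tilde\sigma_A),\qquad d_H(\mathcal N_{B\to A}(\tau_B),\mathcal N_{B\to A}(\tilde\tau_B))\le\gamma\, d_H(\tau_B,\tilde\tau_B).$$ (b) If $\rho_{AB}>0$ (positive definite), put $R_\phi=\langle\phi|\rho_{AB}^\alpha|\phi\rangle=(\langle\phi|\otimes1_B)\rho_{AB}^\alpha(|\phi\rangle\otimes1_B)$, an operator on $B$, for unit vectors $\phi\in A$. Then the maximum in $$\delta=\log\max_{\phi,\psi\in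 A,\ \|\phi\|=\|\psi\|=1}\big\|R_\phi^{-1/2}R_\psi R_\phi^{-1/2}\big\|_\infty\cdot\big\|R_\psi^{-1/2}R_\phi R_\psi^{-1/2}\big\|_\infty$$ is attained ($\|\cdot\|_\infty$ being the operator norm), $\kappa=\tanh(\delta/4)\in[0,1)$, and for all states $\sigma_A,\tilde\sigma_A\sim\rho_A$ on $A$ and all states $\tau_B,\tilde\tau_B\sim\rho_B$ on $B$, $$d_H(\mathcal N_{A\to B}(\sigma_A),\mathcal N_{A\to B}(\tilde\sigma_A))\le\gamma\kappa\, d_H(\sigma_A,\tilde\sigma_A),\qquad d_H(\mathcal N_{B\to A}(\tau_B),\mathcal N_{B\to A}(\tilde\tau_B))\le\gamma\kappa\, d_H(\tau_B,\tilde\tau_B).$$ -/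

import Mathlib

open scoped TensorProduct InnerProductSpace

noncomputable section

/-! ### Hilbert's projective metric of a cone in a real vector space -/

section Cone

/-- The order induced by a cone `C`: `x ≤_C y` iff `y - x ∈ C`. -/
def ConeLE {V : Type*} [AddCommGroup V] (C : Set V) (x y : V) : Prop := y - x ∈ C

/-- `y` dominates `x` with respect to `C`: `a y ≤_C x ≤_C b y` for some real `a`, `b`. -/
def ConeDominates {V : Type*} [AddCommGroup V] [Module ℝ V] (C : Set V) (y x : V) : Prop :=
  ∃ a b : ℝ, ConeLE C (a • y) x ∧ ConeLE C x (b • y)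

/-- `M(x/y) = inf {b ∈ ℝ | x ≤_C b y}`. -/
def coneM {V : Type*} [AddCommGroup V] [Module ℝ V] (C : Set V) (x y : V) : ℝ :=
  sInf {b : ℝ | ConeLE C x (b • y)}

/-- `x` and `y` are equivalent: each dominates the other. -/
def ConeEquiv {V : Type*} [AddCommGroup V] [Module ℝ V] (C : Set V) (x y : V) : Prop :=
  ConeDominates C y x ∧ ConeDominates C x y

open Classical in
/-- Hilbert's projective metric of the cone `C`, for `x` and `y` in `C`, with values in `[0, ∞]`. -/
def hilbertDist {V : Type*} [AddCommGroup V] [Module ℝ V] (C : Set V) (x y : V) : EReal :=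
  if ConeEquiv C x y ∧ y ≠ 0 then ((Real.log (coneM C x y * coneM C y x) : ℝ) : EReal)
  else if x = 0 ∧ y = 0 then 0
  else ⊤

end Cone

/-! ### Operators on finite-dimensional complex Hilbert spaces -/

/-- A finite-dimensional Hilbert space is complete. -/
instance completeSpace_of_finiteDimensional_complex (A : Type*) [NormedAddCommGroup A]
    [InnerProductSpace ℂ A] [FiniteDimensional ℂ A] : CompleteSpace A :=
  FiniteDimensional.complete ℂ A

section Operators

/-- The linear operators on `A`. In finite dimension every linear map is continuous; the norm is
the operator norm. -/
abbrev Op (A : Type*) [NormedAddCommGroup A] [InnerProductSpace ℂ A] : Type _ := A →L[ℂ] A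

variable {A B : Type*} [NormedAddCommGroup A] [InnerProductSpace ℂ A] [FiniteDimensional ℂ A]
  [NormedAddCommGroup B] [InnerProductSpace ℂ B] [FiniteDimensional ℂ B]

/-- The cone of positive semidefinite operators. It lies in the real subspace of self-adjoint
operators; the cone order, `M(x/y)` and the metric only involve membership of differences in the
cone, so it makes no difference that the ambient real vector space is that of all operators. -/
def psdCone (A : Type*) [NormedAddCommGroup A] [InnerProductSpace ℂ A] : Set (Op A) :=
  {X | X.IsPositive}

/-- Hilbert's projective metric on the cone of positive semidefinite operators. -/
def dH (X Y : Op A) : EReal := hilbertDist (psdCone A) X Y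

/-- `X > 0`: the operator `X` is positive definite. -/
def IsPosDefOp (X : Op A) : Prop := X.IsPositive ∧ ∀ v : A, v ≠ 0 → 0 < (⟪v, X v⟫_ℂ).re

/-- The trace of an operator. -/
def opTrace (X : Op A) : ℂ := LinearMap.trace ℂ A X.toLinearMap

/-- The support of an operator: the orthogonal complement of its kernel. -/
def opSupport (X : Op A) : Submodule ℂ A := (LinearMap.ker X.toLinearMap)ᗮ

/-- `X ≪ Y`: the kernel of `Y` is contained in the kernel of `X`. -/
def OpLL (X Y : Op A) : Prop := LinearMap.ker Y.toLinearMap ≤ LinearMap.ker X.toLinearMap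

/-- `X ∼ Y`: the operators have the same support. -/
def OpSim (X Y : Op A) : Prop := opSupport X = opSupport Y

/-- The quantum states on `A`. -/
def states (A : Type*) [NormedAddCommGroup A] [InnerProductSpace ℂ A] [FiniteDimensional ℂ A] :
    Set (Op A) := {ρ | ρ.IsPositive ∧ opTrace ρ = 1}

/-- The states `σ` with `X ≪ σ`. -/
def statesAbove (X : Op A) : Set (Op A) := {σ | σ ∈ states A ∧ OpLL X σ}

/-- The states `σ` with `σ ∼ X`. -/
def statesSim (X : Op A) : Set (Op A) := {σ | σ ∈ states A ∧ OpSim σ X}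

/-- The power `X ^ p` of a positive semidefinite operator, taken on the support of `X`:
the eigenvalue `0` stays `0` and every eigenvalue `x > 0` becomes `x ^ p`. -/
def psdPow (X : Op A) (p : ℝ) : Op A := cfc (fun x : ℝ => if x = 0 then 0 else x ^ p) X

/-- `X_A ⊗ Y_B` as an operator on `A ⊗ B`. -/
def opTensor (X : Op A) (Y : Op B) : Op (A ⊗[ℂ] B) :=
  LinearMap.toContinuousLinearMap (TensorProduct.map X.toLinearMap Y.toLinearMap)

/-- The partial trace over `A`: the linear map determined by `X ⊗ Y ↦ tr[X] Y`. -/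
def ptraceA (Z : Op (A ⊗[ℂ] B)) : Op B :=
  LinearMap.toContinuousLinearMap (TensorProduct.lid ℂ (B →ₗ[ℂ] B)
    (TensorProduct.map (LinearMap.trace ℂ A) LinearMap.id
      ((homTensorHomEquiv ℂ A B A B).symm Z.toLinearMap)))

/-- The partial trace over `B`: the linear map determined by `X ⊗ Y ↦ tr[Y] X`. -/
def ptraceB (Z : Op (A ⊗[ℂ] B)) : Op A :=
  LinearMap.toContinuousLinearMap (TensorProduct.rid ℂ (A →ₗ[ℂ] A)
    (TensorProduct.map LinearMap.id (LinearMap.trace ℂ B)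
      ((homTensorHomEquiv ℂ A B A B).symm Z.toLinearMap)))

/-- The operator `|φ⟩ ⊗ 1_B`, as the linear map `b ↦ φ ⊗ b`. -/
def ketTensor (B : Type*) [NormedAddCommGroup B] [InnerProductSpace ℂ B] [FiniteDimensional ℂ B]
    (φ : A) : B →L[ℂ] A ⊗[ℂ] B :=
  LinearMap.toContinuousLinearMap (TensorProduct.mk ℂ A B φ)

/-- The operator `⟨φ| Z |φ⟩ = (⟨φ| ⊗ 1_B) Z (|φ⟩ ⊗ 1_B)` on `B`. -/
def sandwich (φ : A) (Z : Op (A ⊗[ℂ] B)) : Op B :=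
  ContinuousLinearMap.adjoint (ketTensor B φ) ∘L Z ∘L ketTensor B φ

/-- Division of an operator by its trace. -/
def normalizeTr (X : Op A) : Op A := (opTrace X)⁻¹ • X

/-- The map `N_{A → B}` of alternating minimization of the Petz divergence:
`σ ↦ (tr_A[ρ^α (σ^{1-α} ⊗ 1)])^{1/α}`, divided by its trace. -/
def mapAB (α : ℝ) (ρ : Op (A ⊗[ℂ] B)) (σ : Op A) : Op B :=
  normalizeTr (psdPow (ptraceA (psdPow ρ α * opTensor (psdPow σ (1 - α)) 1)) (1 / α))

/-- The map `N_{B → A}` of alternating minimization of the Petz divergence: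
`τ ↦ (tr_B[ρ^α (1 ⊗ τ^{1-α})])^{1/α}`, divided by its trace. -/
def mapBA (α : ℝ) (ρ : Op (A ⊗[ℂ] B)) (τ : Op B) : Op A :=
  normalizeTr (psdPow (ptraceB (psdPow ρ α * opTensor 1 (psdPow τ (1 - α)))) (1 / α))

/-- `‖Y^{-1/2} X Y^{-1/2}‖`, with the operator norm. -/
def ratioNorm (X Y : Op B) : ℝ := ‖psdPow Y (-1 / 2) * X * psdPow Y (-1 / 2)‖

/-- The values of which `exp δ` is the maximum: for unit vectors `φ, ψ` of `A`, with
`X = ⟨φ|ρ^α|φ⟩` and `Y = ⟨ψ|ρ^α|ψ⟩`, the numbers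
`‖X^{-1/2} Y X^{-1/2}‖ * ‖Y^{-1/2} X Y^{-1/2}‖`. -/
def diamSet (α : ℝ) (ρ : Op (A ⊗[ℂ] B)) : Set ℝ :=
  {r | ∃ φ ψ : A, ‖φ‖ = 1 ∧ ‖ψ‖ = 1 ∧
    r = ratioNorm (sandwich ψ (psdPow ρ α)) (sandwich φ (psdPow ρ α)) *
        ratioNorm (sandwich φ (psdPow ρ α)) (sandwich ψ (psdPow ρ α))}

/-- The projective diameter `δ`. -/
def projDiam (α : ℝ) (ρ : Op (A ⊗[ℂ] B)) : ℝ := Real.log (sSup (diamSet α ρ))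

end Operators

end

/-!
The map `σ ↦ N(σ)` is, up to normalization, a composition of three maps, and each of them is
controlled in Hilbert's projective metric through the domination constants `X ≤ b Y`, `Y ≤ a X`.

* The power `σ ↦ σ^{1-α}`. For `0 < p ≤ 1` the power `x ↦ x^p` is operator monotone
  (Loewner–Heinz), and the pseudo-inverse is operator antitone on operators with a common kernel
  (`psdPow_neg_antitone`). Hence `X ≤ c Y` gives `Y^{1-α} ≤ c^{α-1} X^{1-α}`
  (`psdPow_one_sub_le`): the factor `α - 1`.
* The positive linear map `T X = tr_A[ρ^α (X ⊗ 1)]`. Positivity alone gives the factor `1`. If the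
  cross ratios `⟨χ, T U χ⟩⟨ω, T V ω⟩ / (⟨ω, T U ω⟩⟨χ, T V χ⟩)` are bounded by `D`, Birkhoff's
  theorem (`exists_le_smul_of_birkhoff`) gives the factor `tanh (log D / 4)`. It comes down to the scalar
  inequality `birkhoff_cross` and to `log_birkhoff_le`, which follows from the monotonicity of
  `x ↦ 2 x tanh η - log (cosh (η + x) / cosh (η - x))` on the half-line.
* The root `X ↦ X^{1/α}`, operator monotone again: the factor `1 / α`
  (`dH_normalizeTr_psdPow_le`). Scaling by the trace does not matter.

For `T` and for its counterpart from `B` to `A` the values on vectors are sums of values of the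
quadratic form of `ρ^α` on product vectors (`quadForm_partialMapAB`, `quadForm_partialMapBA`), so
both cross ratio bounds follow from one on product vectors, which is symmetric in `A` and `B`.
The maximum of the latter over unit vectors exists by compactness and equals the maximum of the
norms that define `δ`, since `‖Y^{-1/2} X Y^{-1/2}‖` is the least `c` with `X ≤ c Y`
(`exists_isGreatest_diamSet`). The same formulas identify the kernel of `T (σ^{1-α})` with that of
`ρ_B`, which is the well-definedness.
-/

open scoped TensorProduct InnerProductSpace

noncomputable section

/-! ### Quadratic forms and the order of operators -/

section OpBasics

variable {A : Type*} [NormedAddCommGroup A] [InnerProductSpace ℂ A]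

/-- The real part of the quadratic form `v ↦ ⟨v, X v⟩` of an operator; for self-adjoint operators
these values determine the order. -/
def quadForm (X : Op A) (v : A) : ℝ := (⟪v, X v⟫_ℂ).re

@[simp] lemma quadForm_sub (X Y : Op A) (v : A) :
    quadForm (X - Y) v = quadForm X v - quadForm Y v := by
  simp [quadForm]

@[simp] lemma quadForm_smul (c : ℝ) (X : Op A) (v : A) :
    quadForm (c • X) v = c * quadForm X v := by
  have : (c • X) v = (c : ℂ) • X v := by simp
  rw [quadForm, this, inner_smul_right, Complex.re_ofReal_mul, quadForm]

lemma quadForm_one (v : A) : quadForm 1 v = ‖v‖ ^ 2 := by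
  have := inner_self_eq_norm_sq (𝕜 := ℂ) v
  simpa [quadForm] using this

lemma quadForm_smul_vec (X : Op A) (c : ℂ) (v : A) :
    quadForm X (c • v) = ‖c‖ ^ 2 * quadForm X v := by
  rw [quadForm, map_smul, inner_smul_left, inner_smul_right, ← mul_assoc,
    ← Complex.normSq_eq_conj_mul_self, Complex.re_ofReal_mul, Complex.normSq_eq_norm_sq, quadForm]

lemma quadForm_nonneg {X : Op A} (hX : 0 ≤ X) (v : A) : 0 ≤ quadForm X v :=
  ((ContinuousLinearMap.nonneg_iff_isPositive X).1 hX).re_inner_nonneg_right v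

variable [CompleteSpace A]

lemma le_iff_quadForm {X Y : Op A} (hX : IsSelfAdjoint X) (hY : IsSelfAdjoint Y) :
    X ≤ Y ↔ ∀ v, quadForm X v ≤ quadForm Y v := by
  rw [ContinuousLinearMap.le_def, ContinuousLinearMap.isPositive_def']
  have e : ∀ v, (Y - X).reApplyInnerSelf v = quadForm Y v - quadForm X v := fun v => by
    rw [ContinuousLinearMap.reApplyInnerSelf_apply, ← inner_conj_symm, ← quadForm_sub]
    exact Complex.conj_re _
  exact ⟨fun h v => sub_nonneg.1 (e v ▸ h.2 v),
    fun h => ⟨hY.sub hX, fun v => e v ▸ sub_nonneg.2 (h v)⟩⟩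

lemma quadForm_le {X Y : Op A} (h : X ≤ Y) (v : A) : quadForm X v ≤ quadForm Y v := by
  have := quadForm_nonneg (sub_nonneg.2 h) v
  simpa using this

/-- `⟨v, S X S v⟩ = ⟨S v, X S v⟩` for self-adjoint `S`. -/
lemma quadForm_conj {S : Op A} (hS : IsSelfAdjoint S) (X : Op A) (v : A) :
    quadForm (S * X * S) v = quadForm X (S v) := by
  rw [quadForm, quadForm, mul_apply_eq_comp, mul_apply_eq_comp,
    ← ContinuousLinearMap.adjoint_inner_left, hS.adjoint_eq]

lemma quadForm_mul_self {S : Op A} (hS : IsSelfAdjoint S) (v : A) :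
    quadForm (S * S) v = ‖S v‖ ^ 2 := by
  have := quadForm_conj hS 1 v
  rwa [mul_one, quadForm_one] at this

lemma conj_nonneg_of_selfAdjoint {S X : Op A} (hS : IsSelfAdjoint S) (hX : 0 ≤ X) :
    0 ≤ S * X * S := by
  have := star_right_conjugate_nonneg hX S
  rwa [hS.star_eq] at this

lemma conj_le_of_selfAdjoint {S X Y : Op A} (hS : IsSelfAdjoint S) (h : X ≤ Y) :
    S * X * S ≤ S * Y * S := by
  have := star_right_conjugate_le_conjugate h S
  rwa [hS.star_eq] at this

end OpBasics

/-! ### Powers on the support -/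

section Powers

variable {A : Type*} [NormedAddCommGroup A] [InnerProductSpace ℂ A] [FiniteDimensional ℂ A]

lemma finite_spectrum_op (X : Op A) : (spectrum ℝ X).Finite := by
  have h1 : (spectrum ℂ X).Finite := by
    have h2 : spectrum ℂ X = spectrum ℂ (X.toLinearMap : Module.End ℂ A) := by
      have := AlgEquiv.spectrum_eq (Module.End.toContinuousLinearMap A (𝕜 := ℂ)) X.toLinearMap
      rw [← this]; rfl
    rw [h2]; exact Module.End.finite_spectrum _
  rw [← spectrum.preimage_algebraMap ℂ]
  exact h1.preimage (FaithfulSMul.algebraMap_injective ℝ ℂ).injOn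

/-- In finite dimension the functional calculus accepts every function. -/
lemma continuousOn_spectrum (f : ℝ → ℝ) (X : Op A) : ContinuousOn f (spectrum ℝ X) :=
  (finite_spectrum_op X).continuousOn f

/-- The scalar function whose functional calculus is `psdPow`: the power `x ^ p`, but `0` at `0`. -/
def suppPow (p x : ℝ) : ℝ := if x = 0 then 0 else x ^ p

lemma psdPow_def (X : Op A) (p : ℝ) : psdPow X p = cfc (suppPow p) X := rfl

lemma suppPow_nonneg {p x : ℝ} (hx : 0 ≤ x) : 0 ≤ suppPow p x := by
  unfold suppPow; split_ifs
  · rfl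
  · positivity

lemma spectrum_nonneg_op {X : Op A} (hX : 0 ≤ X) {x : ℝ} (hx : x ∈ spectrum ℝ X) : 0 ≤ x :=
  spectrum_nonneg_of_nonneg hX hx

lemma psdPow_nonneg {X : Op A} (hX : 0 ≤ X) (p : ℝ) : 0 ≤ psdPow X p :=
  cfc_nonneg fun _ hx => suppPow_nonneg (spectrum_nonneg_op hX hx)

lemma isSelfAdjoint_psdPow (X : Op A) (p : ℝ) : IsSelfAdjoint (psdPow X p) :=
  cfc_predicate _ X

lemma psdPow_one {X : Op A} (hX : 0 ≤ X) : psdPow X 1 = X := by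
  have : suppPow 1 = id := by
    ext x; unfold suppPow; split_ifs with h <;> simp [h]
  rw [psdPow_def, this, cfc_id ℝ X (IsSelfAdjoint.of_nonneg hX)]

lemma psdPow_mul {X : Op A} (hX : 0 ≤ X) (p q : ℝ) :
    psdPow X p * psdPow X q = psdPow X (p + q) := by
  rw [psdPow_def, psdPow_def, psdPow_def, ← cfc_mul _ _ X (continuousOn_spectrum _ _)
    (continuousOn_spectrum _ _)]
  refine cfc_congr fun x hx => ?_
  simp only [suppPow]
  split_ifs with h
  · simp
  · rw [Real.rpow_add (lt_of_le_of_ne (spectrum_nonneg_op hX hx) (Ne.symm h))]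

lemma psdPow_mul_self_half {X : Op A} (hX : 0 ≤ X) : psdPow X (1 / 2) * psdPow X (1 / 2) = X := by
  rw [psdPow_mul hX]; norm_num [psdPow_one hX]

/-- For positive exponents the power on the support is the power of the functional calculus. -/
lemma psdPow_eq_rpow {X : Op A} (hX : 0 ≤ X) {p : ℝ} (hp : 0 < p) : psdPow X p = X ^ p := by
  rw [CFC.rpow_eq_cfc_real, psdPow_def]
  refine cfc_congr fun x hx => ?_
  simp only [suppPow]
  split_ifs with h
  · simp [h, Real.zero_rpow hp.ne']
  · rfl

lemma psdPow_smul {X : Op A} (hX : 0 ≤ X) {c : ℝ} (hc : 0 < c) (p : ℝ) :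
    psdPow (c • X) p = c ^ p • psdPow X p := by
  rw [psdPow_def, psdPow_def, ← cfc_smul _ _ _ (continuousOn_spectrum _ _),
    ← cfc_comp_smul c _ X (((finite_spectrum_op X).image _).continuousOn _)
      (IsSelfAdjoint.of_nonneg hX)]
  refine cfc_congr fun x hx => ?_
  simp only [suppPow, smul_eq_mul, mul_eq_zero, hc.ne', false_or]
  split_ifs
  · simp
  · rw [Real.mul_rpow hc.le (spectrum_nonneg_op hX hx)]

/-- Loewner–Heinz, homogeneous form. -/
lemma psdPow_le_smul {X Y : Op A} (hX : 0 ≤ X) (hY : 0 ≤ Y) {c p : ℝ} (hc : 0 < c)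
    (hp0 : 0 < p) (hp1 : p ≤ 1) (h : X ≤ c • Y) : psdPow X p ≤ c ^ p • psdPow Y p := by
  rw [← psdPow_smul hY hc, psdPow_eq_rpow hX hp0, psdPow_eq_rpow (smul_nonneg hc.le hY) hp0]
  exact CFC.rpow_le_rpow ⟨hp0.le, hp1⟩ h

/-- The power with exponent `0` is the support projection. -/
lemma mul_psdPow_zero {X : Op A} (hX : 0 ≤ X) : X * psdPow X 0 = X := by
  nth_rewrite 1 [← psdPow_one hX]
  rw [psdPow_mul hX, add_zero, psdPow_one hX]

lemma psdPow_apply_eq_zero_iff {X : Op A} (hX : 0 ≤ X) (p : ℝ) (v : A) :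
    psdPow X p v = 0 ↔ X v = 0 := by
  constructor <;> intro h
  · have := psdPow_mul hX (1 - p) p
    rw [sub_add_cancel, psdPow_one hX] at this
    rw [← this, mul_apply_eq_comp, h, map_zero]
  · have := psdPow_mul hX (p - 1) 1
    rw [sub_add_cancel, psdPow_one hX] at this
    rw [← this, mul_apply_eq_comp, h, map_zero]

/-- A positive semidefinite quadratic form vanishes exactly on the kernel. -/
lemma quadForm_eq_zero_iff {X : Op A} (hX : 0 ≤ X) (v : A) : quadForm X v = 0 ↔ X v = 0 := by
  conv_lhs => rw [← psdPow_mul_self_half hX]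
  rw [quadForm_mul_self (isSelfAdjoint_psdPow _ _), sq_eq_zero_iff, norm_eq_zero,
    psdPow_apply_eq_zero_iff hX]

/-- If the kernel of `Y` is in that of `X`, the support projection of `Y` fixes `X`. -/
lemma mul_psdPow_zero_of_ker {X Y : Op A} (hY : 0 ≤ Y) (h : ∀ v, Y v = 0 → X v = 0) :
    X * psdPow Y 0 = X := by
  ext v
  have h1 : Y (psdPow Y 0 v - v) = 0 := by
    rw [map_sub, ← mul_apply_eq_comp, mul_psdPow_zero hY, sub_self]
  have h2 := h _ h1
  rw [map_sub, sub_eq_zero] at h2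
  simpa using h2

lemma psdPow_zero_mul_of_ker {X Y : Op A} (hX : 0 ≤ X) (hY : 0 ≤ Y)
    (h : ∀ v, Y v = 0 → X v = 0) : psdPow Y 0 * X = X := by
  have := congrArg star (mul_psdPow_zero_of_ker hY h)
  rwa [star_mul, (isSelfAdjoint_psdPow _ _).star_eq, (IsSelfAdjoint.of_nonneg hX).star_eq] at this

lemma conj_psdPow_neg_half_nonneg {X : Op A} (hX : 0 ≤ X) (Y : Op A) :
    0 ≤ psdPow Y (-1 / 2) * X * psdPow Y (-1 / 2) :=
  conj_nonneg_of_selfAdjoint (isSelfAdjoint_psdPow _ _) hX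

lemma ratioNorm_nonneg (X Y : Op A) : 0 ≤ ratioNorm X Y := norm_nonneg _

/-- Conjugate `Y^{-1/2} X Y^{-1/2} ≤ ‖Y^{-1/2} X Y^{-1/2}‖` by `Y^{1/2}`. The kernel condition makes
the support projection of `Y` disappear on the left. -/
lemma le_ratioNorm_smul {X Y : Op A} (hX : 0 ≤ X) (hY : 0 ≤ Y) (h : ∀ v, Y v = 0 → X v = 0) :
    X ≤ ratioNorm X Y • Y := by
  have h0 := conj_psdPow_neg_half_nonneg hX Y
  have h1 := (CStarAlgebra.norm_le_iff_le_algebraMap _ (ratioNorm_nonneg X Y) h0).1 le_rfl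
  have h2 := conj_le_of_selfAdjoint (isSelfAdjoint_psdPow Y (1 / 2)) h1
  have e1 : psdPow Y (1 / 2) * (psdPow Y (-1 / 2) * X * psdPow Y (-1 / 2)) * psdPow Y (1 / 2)
      = X := by
    have e : psdPow Y (1 / 2) * (psdPow Y (-1 / 2) * X * psdPow Y (-1 / 2)) * psdPow Y (1 / 2)
      = (psdPow Y (1 / 2) * psdPow Y (-1 / 2)) * X * (psdPow Y (-1 / 2) * psdPow Y (1 / 2)) := by
      simp only [mul_assoc]
    rw [e, psdPow_mul hY, psdPow_mul hY]
    norm_num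
    rw [psdPow_zero_mul_of_ker hX hY h, mul_psdPow_zero_of_ker hY h]
  rw [e1, Algebra.algebraMap_eq_smul_one, mul_smul_comm, mul_one, smul_mul_assoc,
    psdPow_mul_self_half hY] at h2
  exact h2

lemma psdPow_zero_le_one {X : Op A} : psdPow X 0 ≤ 1 := by
  refine cfc_le_one _ _ fun x _ => ?_
  split_ifs <;> simp

/-- With `le_ratioNorm_smul`: the norm is the least `c ≥ 0` with `X ≤ c Y`. -/
lemma ratioNorm_le {X Y : Op A} (hX : 0 ≤ X) (hY : 0 ≤ Y) {c : ℝ} (hc : 0 ≤ c)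
    (h : X ≤ c • Y) : ratioNorm X Y ≤ c := by
  refine (CStarAlgebra.norm_le_iff_le_algebraMap _ hc (conj_psdPow_neg_half_nonneg hX Y)).2 ?_
  refine (conj_le_of_selfAdjoint (isSelfAdjoint_psdPow _ _) h).trans ?_
  have e : psdPow Y (-1 / 2) * Y * psdPow Y (-1 / 2) = psdPow Y 0 := by
    conv_lhs => enter [1, 2]; rw [← psdPow_one hY]
    rw [psdPow_mul hY, psdPow_mul hY]; norm_num
  rw [mul_smul_comm, smul_mul_assoc, e, Algebra.algebraMap_eq_smul_one]
  exact smul_le_smul_of_nonneg_left psdPow_zero_le_one hc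

/-- The pseudo-inverse reverses the order of operators with the same support: expand
`0 ≤ (c X⁻¹ - Y⁻¹) X (c X⁻¹ - Y⁻¹)` and use `X ≤ c Y`. -/
lemma psdPow_neg_antitone {X Y : Op A} (hX : 0 ≤ X) (hY : 0 ≤ Y) (hker : ∀ v, X v = 0 ↔ Y v = 0)
    {c : ℝ} (hc : 0 < c) (h : X ≤ c • Y) : psdPow Y (-1) ≤ c • psdPow X (-1) := by
  set X' := psdPow X (-1) with hX'
  set Y' := psdPow Y (-1) with hY'
  have sX : IsSelfAdjoint X' := isSelfAdjoint_psdPow _ _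
  have sY : IsSelfAdjoint Y' := isSelfAdjoint_psdPow _ _
  have h1 : 0 ≤ (c • X' - Y') * X * (c • X' - Y') :=
    conj_nonneg_of_selfAdjoint (((IsSelfAdjoint.all c).smul sX).sub sY) hX
  have e1 : X' * X = psdPow X 0 := by
    rw [hX']; nth_rewrite 2 [← psdPow_one hX]; rw [psdPow_mul hX]; norm_num
  have e2 : X * X' = psdPow X 0 := by
    rw [hX']; nth_rewrite 1 [← psdPow_one hX]; rw [psdPow_mul hX]; norm_num
  have kY : ∀ v, X v = 0 → Y' v = 0 := fun v hv =>
    (psdPow_apply_eq_zero_iff hY _ v).2 ((hker v).1 hv)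
  have e3 : psdPow X 0 * X' = X' := by rw [hX', psdPow_mul hX]; norm_num
  have e4 : psdPow X 0 * Y' = Y' := psdPow_zero_mul_of_ker (psdPow_nonneg hY _) hX kY
  have e5 : Y' * psdPow X 0 = Y' := mul_psdPow_zero_of_ker hX kY
  have e6 : Y' * Y * Y' = Y' := by
    rw [hY']; conv_lhs => enter [1, 2]; rw [← psdPow_one hY]
    rw [psdPow_mul hY, psdPow_mul hY]; norm_num
  have h2 : Y' * X * Y' ≤ c • Y' := by
    have := conj_le_of_selfAdjoint sY h
    rwa [mul_smul_comm, smul_mul_assoc, e6] at this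
  have e7 : (c • X' - Y') * X * (c • X' - Y')
      = (c * c) • X' - (2 * c) • Y' + Y' * X * Y' := by
    have : (c • X' - Y') * X * (c • X' - Y') = (c * c) • (X' * X * X') - c • (X' * X * Y')
        - c • (Y' * (X * X')) + Y' * X * Y' := by
      simp only [sub_mul, mul_sub, smul_mul_assoc, mul_smul_comm, mul_assoc]
      module
    rw [this, e1, e2, e3, e4, e5]
    module
  have h3 : c • Y' ≤ c • (c • X') := by
    rw [← sub_nonneg]
    have : 0 ≤ (c * c) • X' - (2 * c) • Y' + c • Y' := by
      rw [e7] at h1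
      exact h1.trans (add_le_add_right h2 _)
    convert this using 1
    module
  exact le_of_smul_le_smul_of_pos_left h3 hc

/-- Powers with exponents in `[-1, 0)` are antitone on operators with the same support. -/
lemma psdPow_antitone {X Y : Op A} (hX : 0 ≤ X) (hY : 0 ≤ Y) (hker : ∀ v, X v = 0 ↔ Y v = 0)
    {c p : ℝ} (hc : 0 < c) (hp0 : 0 < p) (hp1 : p ≤ 1) (h : X ≤ c • Y) :
    psdPow Y (-p) ≤ c ^ p • psdPow X (-p) := by
  have key : ∀ {Z : Op A}, 0 ≤ Z → psdPow (psdPow Z p) (-1) = psdPow Z (-p) := by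
    intro Z hZ
    rw [psdPow_def, psdPow_def Z p, psdPow_def, ← cfc_comp' _ _ Z
      (((finite_spectrum_op Z).image _).continuousOn _) (continuousOn_spectrum _ _)
      (IsSelfAdjoint.of_nonneg hZ)]
    refine cfc_congr fun x hx => ?_
    have hx0 := spectrum_nonneg_op hZ hx
    simp only [suppPow]
    by_cases hxx : x = 0
    · simp [hxx]
    · have : 0 < x ^ p := Real.rpow_pos_of_pos (lt_of_le_of_ne hx0 (Ne.symm hxx)) _
      simp only [hxx, if_false, this.ne']
      rw [← Real.rpow_mul hx0]; simp
  rw [← key hX, ← key hY]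
  refine psdPow_neg_antitone (psdPow_nonneg hX _) (psdPow_nonneg hY _) (fun v => ?_)
    (Real.rpow_pos_of_pos hc _) (psdPow_le_smul hX hY hc hp0 hp1 h)
  rw [psdPow_apply_eq_zero_iff hX, psdPow_apply_eq_zero_iff hY, hker]

lemma psdPow_one_sub_le {α : ℝ} (hα : α ∈ Set.Ioc (1 : ℝ) 2) {X Y : Op A} (hX : 0 ≤ X)
    (hY : 0 ≤ Y) (hker : ∀ v, X v = 0 ↔ Y v = 0) {c : ℝ} (hc : 0 < c) (h : X ≤ c • Y) :
    psdPow Y (1 - α) ≤ c ^ (α - 1) • psdPow X (1 - α) := by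
  have := psdPow_antitone hX hY hker hc (p := α - 1) (by linarith [hα.1]) (by linarith [hα.2]) h
  rwa [neg_sub] at this

end Powers

/-! ### Domination constants and Hilbert's metric -/

section Metric

variable {A : Type*} [NormedAddCommGroup A] [InnerProductSpace ℂ A] [FiniteDimensional ℂ A]
  {X Y : Op A}

lemma exists_quadForm_pos (hX : 0 ≤ X) (hX0 : X ≠ 0) : ∃ v, 0 < quadForm X v := by
  by_contra! h
  refine hX0 (ContinuousLinearMap.ext fun v => ?_)
  exact (quadForm_eq_zero_iff hX v).1 (le_antisymm (h v) (quadForm_nonneg hX v))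

lemma pos_of_le_smul (hX : 0 ≤ X) (hX0 : X ≠ 0) (hY : 0 ≤ Y) {b : ℝ} (h : X ≤ b • Y) : 0 < b := by
  obtain ⟨v, hv⟩ := exists_quadForm_pos hX hX0
  have h1 := hv.trans_le (quadForm_le h v)
  rw [quadForm_smul] at h1
  exact pos_of_mul_pos_left h1 (quadForm_nonneg hY v)

lemma coneM_le (hX : 0 ≤ X) (hX0 : X ≠ 0) (hY : 0 ≤ Y) {b : ℝ} (h : X ≤ b • Y) :
    coneM (psdCone A) X Y ≤ b :=
  csInf_le ⟨0, fun _ hc => (pos_of_le_smul hX hX0 hY hc).le⟩ h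

/-- The infimum defining `M(X/Y)` is attained, the cone being closed. -/
lemma le_coneM_smul (hX : 0 ≤ X) (hY : 0 ≤ Y) {b : ℝ} (h : X ≤ b • Y) :
    X ≤ coneM (psdCone A) X Y • Y := by
  refine (le_iff_quadForm (.of_nonneg hX)
    ((IsSelfAdjoint.all _).smul (.of_nonneg hY))).2 fun v => ?_
  rw [quadForm_smul]
  rcases (quadForm_nonneg hY v).eq_or_lt with h0 | h0
  · have := quadForm_le h v
    rw [quadForm_smul] at this
    simpa [← h0] using this
  · rw [← div_le_iff₀ h0]
    refine le_csInf ⟨b, h⟩ fun c hc => ?_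
    have := quadForm_le (show X ≤ c • Y from hc) v
    rwa [quadForm_smul, ← div_le_iff₀ h0] at this

lemma coneM_pos (hX : 0 ≤ X) (hX0 : X ≠ 0) (hY : 0 ≤ Y) {b : ℝ} (h : X ≤ b • Y) :
    0 < coneM (psdCone A) X Y :=
  pos_of_le_smul hX hX0 hY (le_coneM_smul hX hY h)

omit [FiniteDimensional ℂ A] in
lemma dH_eq_log (hX : 0 ≤ X) (hY : 0 ≤ Y) (hY0 : Y ≠ 0) {a b : ℝ} (h : X ≤ b • Y)
    (h' : Y ≤ a • X) :
    dH X Y = ((Real.log (coneM (psdCone A) X Y * coneM (psdCone A) Y X) : ℝ) : EReal) := by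
  have key : ∀ {Z W : Op A} {c : ℝ}, 0 ≤ Z → Z ≤ c • W → ConeDominates (psdCone A) W Z :=
    fun {Z W c} hZ h => ⟨0, c, by rw [zero_smul]; exact hZ, h⟩
  exact if_pos ⟨⟨key hX h, key hY h'⟩, hY0⟩

lemma dH_le_log (hX : 0 ≤ X) (hX0 : X ≠ 0) (hY : 0 ≤ Y) (hY0 : Y ≠ 0) {a b : ℝ} (h : X ≤ b • Y)
    (h' : Y ≤ a • X) : dH X Y ≤ ((Real.log (b * a) : ℝ) : EReal) := by
  rw [dH_eq_log hX hY hY0 h h', EReal.coe_le_coe_iff]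
  have p1 := coneM_pos hX hX0 hY h
  have p2 := coneM_pos hY hY0 hX h'
  exact Real.log_le_log (mul_pos p1 p2) (mul_le_mul (coneM_le hX hX0 hY h)
    (coneM_le hY hY0 hX h') p2.le (pos_of_le_smul hX hX0 hY h).le)

/-- On nonzero operators with the same kernel, the metric is the logarithm of a product of optimal
domination constants. -/
lemma exists_dH_eq_log (hX : 0 ≤ X) (hX0 : X ≠ 0) (hY : 0 ≤ Y) (hY0 : Y ≠ 0)
    (hker : ∀ v, X v = 0 ↔ Y v = 0) :
    ∃ b a : ℝ, 0 < b ∧ 0 < a ∧ X ≤ b • Y ∧ Y ≤ a • X ∧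
      dH X Y = ((Real.log (b * a) : ℝ) : EReal) := by
  have h := le_ratioNorm_smul hX hY fun v => (hker v).2
  have h' := le_ratioNorm_smul hY hX fun v => (hker v).1
  exact ⟨_, _, coneM_pos hX hX0 hY h, coneM_pos hY hY0 hX h', le_coneM_smul hX hY h,
    le_coneM_smul hY hX h', dH_eq_log hX hY hY0 h h'⟩

/-- A bound on all cross ratios of the quadratic forms yields domination constants with the same
bound on their product. -/
lemma exists_le_smul_of_cross (hX : 0 ≤ X) (hX0 : X ≠ 0) (hY : 0 ≤ Y) (hY0 : Y ≠ 0) {a b K : ℝ}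
    (h : X ≤ b • Y) (h' : Y ≤ a • X)
    (hK : ∀ v w, quadForm X v * quadForm Y w ≤ K * (quadForm Y v * quadForm X w)) :
    ∃ p q : ℝ, 0 < p ∧ 0 < q ∧ X ≤ p • Y ∧ Y ≤ q • X ∧ p * q ≤ K := by
  have p1 := coneM_pos hX hX0 hY h
  refine ⟨_, _, p1, coneM_pos hY hY0 hX h', le_coneM_smul hX hY h, le_coneM_smul hY hX h', ?_⟩
  set p := coneM (psdCone A) X Y with hp
  rw [mul_comm, ← le_div_iff₀ p1]
  refine coneM_le hY hY0 hX ((le_iff_quadForm (.of_nonneg hY)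
    ((IsSelfAdjoint.all _).smul (.of_nonneg hX))).2 fun w => ?_)
  rw [quadForm_smul, div_mul_eq_mul_div, le_div_iff₀ p1]
  -- A vector `w` of the kernel of `Y` is also in that of `X`; any other bounds `M(X/Y)`.
  rcases (quadForm_nonneg hY w).eq_or_lt with h0 | h0
  · have h1 := quadForm_le h w
    rw [quadForm_smul, ← h0, mul_zero] at h1
    rw [← h0, le_antisymm h1 (quadForm_nonneg hX w)]
    simp
  · rw [mul_comm, ← le_div_iff₀ h0]
    refine coneM_le hX hX0 hY ((le_iff_quadForm (.of_nonneg hX)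
      ((IsSelfAdjoint.all _).smul (.of_nonneg hY))).2 fun v => ?_)
    rw [quadForm_smul, div_mul_eq_mul_div, le_div_iff₀ h0]
    linarith [hK v w]

lemma one_le_mul_of_le_smul (hX : 0 ≤ X) (hX0 : X ≠ 0) (hY : 0 ≤ Y) {a b : ℝ} (h : X ≤ b • Y)
    (h' : Y ≤ a • X) : 1 ≤ b * a := by
  obtain ⟨v, hv⟩ := exists_quadForm_pos hX hX0
  have h1 := quadForm_le h v
  have h2 := quadForm_le h' v
  rw [quadForm_smul] at h1 h2
  have h3 := mul_le_mul_of_nonneg_left h2 (pos_of_le_smul hX hX0 hY h).le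
  by_contra! hlt
  nlinarith

end Metric

/-! ### The scalar inequalities in Birkhoff's theorem -/

section RealInequalities

/-- The elementary inequality behind Birkhoff's contraction theorem, in coordinates in which the two
points are `u + p v` and `q u + v`, with `t² = p q` and `d²` the bound on the cross ratio. The
arithmetic–geometric mean inequality reduces it to one between linear forms in the square roots of
`u v₂` and `v u₂`. -/
lemma birkhoff_cross_aux {p q t d u v u₂ v₂ : ℝ} (hp : 0 < p) (hq : 0 < q) (ht1 : 1 ≤ t)
    (hd1 : 1 ≤ d) (ht2 : t ^ 2 = p * q) (hu : 0 ≤ u) (hv : 0 ≤ v) (hu₂ : 0 ≤ u₂) (hv₂ : 0 ≤ v₂)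
    (hc : v * u₂ ≤ d ^ 2 * (u * v₂)) :
    (u + p * v) * (q * u₂ + v₂) ≤
      ((1 + t * d) / (t + d)) ^ 2 * ((q * u + v) * (u₂ + p * v₂)) := by
  have htd : 0 < t + d := by linarith
  obtain ⟨k, hk⟩ : ∃ k, k = (1 + t * d) / (t + d) := ⟨_, rfl⟩
  rw [← hk]
  have hk1 : 1 ≤ k := by
    rw [hk, le_div_iff₀ htd]
    nlinarith [mul_nonneg (sub_nonneg.2 ht1) (sub_nonneg.2 hd1)]
  have hk2 : 1 ≤ k ^ 2 := one_le_pow₀ hk1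
  obtain ⟨s, hs0, hs2⟩ : ∃ s, 0 ≤ s ∧ s ^ 2 = u * v₂ :=
    ⟨√(u * v₂), Real.sqrt_nonneg _, Real.sq_sqrt (mul_nonneg hu hv₂)⟩
  obtain ⟨r, hr0, hr2⟩ : ∃ r, 0 ≤ r ∧ r ^ 2 = v * u₂ :=
    ⟨√(v * u₂), Real.sqrt_nonneg _, Real.sq_sqrt (mul_nonneg hv hu₂)⟩
  have hrs : r ≤ d * s := by
    refine (abs_le_of_sq_le_sq' ?_ (by positivity)).2
    rw [mul_pow, hr2, hs2]; exact hc
  -- the arithmetic–geometric mean inequality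
  have hw : 2 * t * (s * r) ≤ q * (u * u₂) + p * (v * v₂) := by
    refine (abs_le_of_sq_le_sq' ?_ (by positivity)).2
    have : (2 * t * (s * r)) ^ 2 = 4 * (q * (u * u₂)) * (p * (v * v₂)) := by
      calc _ = 4 * t ^ 2 * (s ^ 2 * r ^ 2) := by ring
        _ = _ := by rw [ht2, hs2, hr2]; ring
    linarith [sq_nonneg (q * (u * u₂) - p * (v * v₂))]
  have hlin : s + t * r ≤ k * (t * s + r) := by
    rw [hk, div_mul_eq_mul_div, le_div_iff₀ htd]
    have : 0 ≤ (d * s - r) * (t ^ 2 - 1) :=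
      mul_nonneg (sub_nonneg.2 hrs) (sub_nonneg.2 (one_le_pow₀ ht1))
    linarith
  have hsq : (s + t * r) ^ 2 ≤ k ^ 2 * (t * s + r) ^ 2 := by
    rw [← mul_pow]; exact pow_le_pow_left₀ (by positivity) hlin 2
  have l : (u + p * v) * (q * u₂ + v₂)
      = (q * (u * u₂) + p * (v * v₂) - 2 * t * (s * r)) + (s + t * r) ^ 2 := by
    linear_combination (-1 : ℝ) * hs2 - t ^ 2 * hr2 - (v * u₂) * ht2
  have l' : (q * u + v) * (u₂ + p * v₂)
      = (q * (u * u₂) + p * (v * v₂) - 2 * t * (s * r)) + (t * s + r) ^ 2 := by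
    linear_combination (-1 : ℝ) * hr2 - t ^ 2 * hs2 - (u * v₂) * ht2
  rw [l, l', mul_add]
  exact add_le_add (le_mul_of_one_le_left (sub_nonneg.2 hw) hk2) hsq

/-- The scalar form of Birkhoff's theorem: `x, x'` and `y, y'` are the values of two positive
functionals at two points, `p` and `q` the domination constants of the points, and `D` bounds the
cross ratio. -/
lemma birkhoff_cross {p q D x x' y y' : ℝ} (hp : 0 < p) (hq : 0 < q) (hD : 1 ≤ D)
    (hpq : 1 ≤ p * q) (hx : 0 ≤ x) (hy' : 0 ≤ y')
    (hu : 0 ≤ p * x' - x) (hv : 0 ≤ q * x - x') (hu₂ : 0 ≤ p * y' - y) (hv₂ : 0 ≤ q * y - y')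
    (hc : (q * x - x') * (p * y' - y) ≤ D * ((p * x' - x) * (q * y - y'))) :
    x * y' ≤ ((1 + √(p * q) * √D) / (√(p * q) + √D)) ^ 2 * (x' * y) := by
  have hx' : 0 ≤ x' := nonneg_of_mul_nonneg_right (by linarith : 0 ≤ p * x') hp
  have hy : 0 ≤ y := nonneg_of_mul_nonneg_right (by linarith : 0 ≤ q * y) hq
  have ht2 : √(p * q) ^ 2 = p * q := Real.sq_sqrt (by positivity)
  have hd2 : √D ^ 2 = D := Real.sq_sqrt (by positivity)
  have ht1 : 1 ≤ √(p * q) := Real.one_le_sqrt.2 hpq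
  have hd1 : 1 ≤ √D := Real.one_le_sqrt.2 hD
  rcases hpq.eq_or_lt with h1 | h1
  · -- The two points are proportional.
    have a1 : x = p * x' := by linarith [mul_nonneg hp.le hv, congrArg (· * x) h1]
    have a2 : y = p * y' := by linarith [mul_nonneg hp.le hv₂, congrArg (· * y) h1]
    have hp1 : ((1 + √(p * q) * √D) / (√(p * q) + √D)) = 1 := by
      rw [← h1, Real.sqrt_one, one_mul]
      exact div_self (by positivity)
    rw [hp1, a1, a2]
    exact le_of_eq (by ring)
  · have hmain := birkhoff_cross_aux hp hq ht1 hd1 ht2 hu hv hu₂ hv₂ (by rwa [hd2])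
    have hpos : 0 < (p * q - 1) ^ 2 := pow_pos (sub_pos.2 h1) 2
    refine le_of_mul_le_mul_left ?_ hpos
    calc _ = (p * x' - x + p * (q * x - x')) * (q * (p * y' - y) + (q * y - y')) := by ring
      _ ≤ _ := hmain
      _ = _ := by ring

lemma log_cosh_sub_le {η τ : ℝ} (hη : 0 ≤ η) (hτ : 0 ≤ τ) :
    Real.log (Real.cosh (η + τ)) - Real.log (Real.cosh (η - τ)) ≤ Real.tanh η * (2 * τ) := by
  set g : ℝ → ℝ := fun x => Real.tanh η * (2 * x) -
    (Real.log (Real.cosh (η + x)) - Real.log (Real.cosh (η - x))) with hg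
  have hd : ∀ x, HasDerivAt g (Real.tanh η * 2 -
      (Real.sinh (η + x) / Real.cosh (η + x) + Real.sinh (η - x) / Real.cosh (η - x))) x := by
    intro x
    have h1 : HasDerivAt (fun x => Real.log (Real.cosh (η + x)))
        (Real.sinh (η + x) / Real.cosh (η + x)) x := by
      simpa using (((hasDerivAt_id x).const_add η).cosh).log (Real.cosh_pos _).ne'
    have h2 : HasDerivAt (fun x => Real.log (Real.cosh (η - x)))
        (-(Real.sinh (η - x) / Real.cosh (η - x))) x := by
      simpa [neg_div] using (((hasDerivAt_id x).const_sub η).cosh).log (Real.cosh_pos _).ne'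
    have h3 : HasDerivAt (fun x : ℝ => Real.tanh η * (2 * x)) (Real.tanh η * 2) x := by
      simpa using ((hasDerivAt_id x).const_mul 2).const_mul (Real.tanh η)
    have h4 := h3.sub (h1.sub h2)
    rw [sub_neg_eq_add] at h4
    exact h4
  have hmono : Monotone g := by
    refine monotone_of_deriv_nonneg (fun x => (hd x).differentiableAt) fun x => ?_
    rw [(hd x).deriv, sub_nonneg, Real.tanh_eq_sinh_div_cosh]
    have c1 := Real.cosh_pos (η + x)
    have c2 := Real.cosh_pos (η - x)
    have c3 := Real.cosh_pos η
    have s3 : 0 ≤ Real.sinh η := Real.sinh_nonneg_iff.2 hη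
    rw [div_add_div _ _ c1.ne' c2.ne', div_mul_eq_mul_div, div_le_div_iff₀ (by positivity) c3]
    rw [Real.sinh_add, Real.sinh_sub, Real.cosh_add, Real.cosh_sub]
    have q1 := Real.cosh_sq η
    have q2 := Real.cosh_sq x
    have : Real.sinh η * 2 * ((Real.cosh η * Real.cosh x + Real.sinh η * Real.sinh x) *
        (Real.cosh η * Real.cosh x - Real.sinh η * Real.sinh x)) -
        ((Real.sinh η * Real.cosh x + Real.cosh η * Real.sinh x) *
          (Real.cosh η * Real.cosh x - Real.sinh η * Real.sinh x) +
        (Real.cosh η * Real.cosh x + Real.sinh η * Real.sinh x) *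
          (Real.sinh η * Real.cosh x - Real.cosh η * Real.sinh x)) * Real.cosh η
        = 2 * Real.sinh η * Real.sinh x ^ 2 := by
      linear_combination
        (2 * Real.sinh η * Real.sinh x ^ 2) * q1
    nlinarith [mul_nonneg s3 (sq_nonneg (Real.sinh x))]
  have h0 := hmono hτ
  simp only [hg] at h0
  simp at h0
  linarith

/-- The Birkhoff bound in logarithmic form: the contraction ratio is `tanh (log D / 4)`. -/
lemma log_birkhoff_le {P D : ℝ} (hP : 1 ≤ P) (hD : 1 ≤ D) :
    Real.log (((1 + √P * √D) / (√P + √D)) ^ 2) ≤ Real.tanh (Real.log D / 4) * Real.log P := by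
  have key : ∀ {x : ℝ}, 1 ≤ x → √x = Real.exp (Real.log x / 2) := fun {x} hx => by
    rw [Real.exp_half, Real.exp_log (by linarith)]
  set τ := Real.log P / 4 with hτ
  set η := Real.log D / 4 with hη
  have e : (1 + √P * √D) / (√P + √D) = Real.cosh (η + τ) / Real.cosh (η - τ) := by
    rw [key hP, key hD]
    have e1 : Real.log P / 2 = 2 * τ := by rw [hτ]; ring
    have e2 : Real.log D / 2 = 2 * η := by rw [hη]; ring
    rw [e1, e2, Real.cosh_eq, Real.cosh_eq, div_eq_div_iff (by positivity) (by positivity)]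
    have a1 : Real.exp (2 * τ) = Real.exp τ * Real.exp τ := by rw [← Real.exp_add]; ring_nf
    have a2 : Real.exp (2 * η) = Real.exp η * Real.exp η := by rw [← Real.exp_add]; ring_nf
    have a3 : Real.exp (η + τ) = Real.exp η * Real.exp τ := Real.exp_add _ _
    have a4 : Real.exp (-(η + τ)) = (Real.exp η)⁻¹ * (Real.exp τ)⁻¹ := by
      rw [neg_add, Real.exp_add, Real.exp_neg, Real.exp_neg]
    have a5 : Real.exp (η - τ) = Real.exp η * (Real.exp τ)⁻¹ := by
      rw [sub_eq_add_neg, Real.exp_add, Real.exp_neg]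
    have a6 : Real.exp (-(η - τ)) = (Real.exp η)⁻¹ * Real.exp τ := by
      rw [neg_sub, sub_eq_add_neg, Real.exp_add, Real.exp_neg, mul_comm]
    rw [a1, a2, a3, a4, a5, a6]
    have b1 := (Real.exp_pos η).ne'
    have b2 := (Real.exp_pos τ).ne'
    field_simp
    ring
  rw [e, Real.log_pow, Real.log_div (Real.cosh_pos _).ne' (Real.cosh_pos _).ne']
  have hP0 : 0 ≤ τ := by have := Real.log_nonneg hP; positivity
  have hD0 : 0 ≤ η := by have := Real.log_nonneg hD; positivity
  have := log_cosh_sub_le hD0 hP0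
  have e3 : Real.log P = 4 * τ := by rw [hτ]; ring
  rw [e3]
  push_cast
  linarith

end RealInequalities

/-! ### Partial traces as positive maps -/

section PartialTrace

open scoped ComplexOrder

variable {A B : Type*} [NormedAddCommGroup A] [InnerProductSpace ℂ A] [FiniteDimensional ℂ A]
  [NormedAddCommGroup B] [InnerProductSpace ℂ B] [FiniteDimensional ℂ B]

omit [FiniteDimensional ℂ A] in
lemma nonneg_of_inner {X : Op A} (h : ∀ v, 0 ≤ ⟪v, X v⟫_ℂ) : 0 ≤ X := by
  rw [ContinuousLinearMap.nonneg_iff_isPositive, ContinuousLinearMap.isPositive_iff_complex]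
  intro v
  have h1 : ⟪X v, v⟫_ℂ = ⟪v, X v⟫_ℂ := by
    rw [← inner_conj_symm]; exact Complex.conj_eq_iff_im.2 (Complex.nonneg_iff.1 (h v)).2.symm
  rw [h1]
  exact ⟨Complex.ext rfl (Complex.nonneg_iff.1 (h v)).2, (Complex.nonneg_iff.1 (h v)).1⟩

lemma inner_ptraceA {ι : Type*} [Fintype ι] (e : OrthonormalBasis ι ℂ A) (W : Op (A ⊗[ℂ] B))
    (χ ω : B) : ⟪χ, ptraceA W ω⟫_ℂ = ∑ i, ⟪e i ⊗ₜ[ℂ] χ, W (e i ⊗ₜ[ℂ] ω)⟫_ℂ := by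
  obtain ⟨w, hw⟩ := (homTensorHomEquiv ℂ A B A B).surjective W.toLinearMap
  have h1 : ∀ x, W x = homTensorHomEquiv ℂ A B A B w x := fun x => by rw [hw]; rfl
  have h2 : ptraceA W ω = TensorProduct.lid ℂ (B →ₗ[ℂ] B)
      (TensorProduct.map (LinearMap.trace ℂ A) LinearMap.id w) ω := by
    rw [ptraceA, ← hw, LinearEquiv.symm_apply_apply]; rfl
  simp only [h1, h2]
  clear hw h1 h2
  induction w with
  | zero => simp
  | add x y hx hy => simp [inner_add_right, Finset.sum_add_distrib, hx, hy]
  | tmul f g =>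
    simp [homTensorHomEquiv_apply, LinearMap.trace_eq_sum_inner f e, Finset.sum_mul]

lemma inner_ptraceB {ι : Type*} [Fintype ι] (e : OrthonormalBasis ι ℂ B) (W : Op (A ⊗[ℂ] B))
    (φ ψ : A) : ⟪φ, ptraceB W ψ⟫_ℂ = ∑ i, ⟪φ ⊗ₜ[ℂ] e i, W (ψ ⊗ₜ[ℂ] e i)⟫_ℂ := by
  obtain ⟨w, hw⟩ := (homTensorHomEquiv ℂ A B A B).surjective W.toLinearMap
  have h1 : ∀ x, W x = homTensorHomEquiv ℂ A B A B w x := fun x => by rw [hw]; rfl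
  have h2 : ptraceB W ψ = TensorProduct.rid ℂ (A →ₗ[ℂ] A)
      (TensorProduct.map LinearMap.id (LinearMap.trace ℂ B) w) ψ := by
    rw [ptraceB, ← hw, LinearEquiv.symm_apply_apply]; rfl
  simp only [h1, h2]
  clear hw h1 h2
  induction w with
  | zero => simp
  | add x y hx hy => simp [inner_add_right, Finset.sum_add_distrib, hx, hy]
  | tmul f g =>
    simp [homTensorHomEquiv_apply, LinearMap.trace_eq_sum_inner g e, Finset.mul_sum, mul_comm]

lemma opTensor_tmul (X : Op A) (Y : Op B) (a : A) (b : B) :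
    opTensor X Y (a ⊗ₜ[ℂ] b) = X a ⊗ₜ[ℂ] Y b := rfl

/-- The linear map `X ↦ tr_A[Z (X ⊗ 1)]`, which is positive for positive `Z`. -/
def partialMapAB (Z : Op (A ⊗[ℂ] B)) : Op A →ₗ[ℝ] Op B where
  toFun X := ptraceA (Z * opTensor X 1)
  map_add' X Y := by
    refine ContinuousLinearMap.ext fun ω => ext_inner_left ℂ fun χ => ?_
    simp [inner_ptraceA (stdOrthonormalBasis ℂ A), opTensor_tmul, inner_add_right,
      TensorProduct.add_tmul, Finset.sum_add_distrib]
  map_smul' c X := by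
    refine ContinuousLinearMap.ext fun ω => ext_inner_left ℂ fun χ => ?_
    have h : ∀ v, (c • X) v = (c : ℂ) • X v := fun v => by simp
    have h' : ∀ (Y : Op B) v, (c • Y) v = (c : ℂ) • Y v := fun Y v => by simp
    simp only [RingHom.id_apply, h', inner_smul_right]
    simp only [inner_ptraceA (stdOrthonormalBasis ℂ A), mul_apply_eq_comp, opTensor_tmul, h,
      ← TensorProduct.smul_tmul', map_smul, Finset.mul_sum]
    exact Finset.sum_congr rfl fun i _ =>
      inner_smul_right (𝕜 := ℂ) (E := A ⊗[ℂ] B) _ _ _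

/-- The linear map `Y ↦ tr_B[Z (1 ⊗ Y)]`, which is positive for positive `Z`. -/
def partialMapBA (Z : Op (A ⊗[ℂ] B)) : Op B →ₗ[ℝ] Op A where
  toFun Y := ptraceB (Z * opTensor 1 Y)
  map_add' X Y := by
    refine ContinuousLinearMap.ext fun ω => ext_inner_left ℂ fun χ => ?_
    simp [inner_ptraceB (stdOrthonormalBasis ℂ B), opTensor_tmul, inner_add_right,
      TensorProduct.tmul_add, Finset.sum_add_distrib]
  map_smul' c X := by
    refine ContinuousLinearMap.ext fun ω => ext_inner_left ℂ fun χ => ?_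
    have h : ∀ v, (c • X) v = (c : ℂ) • X v := fun v => by simp
    have h' : ∀ (Y : Op A) v, (c • Y) v = (c : ℂ) • Y v := fun Y v => by simp
    simp only [RingHom.id_apply, h', inner_smul_right]
    simp only [inner_ptraceB (stdOrthonormalBasis ℂ B), mul_apply_eq_comp, opTensor_tmul, h,
      TensorProduct.tmul_smul, map_smul, Finset.mul_sum]
    exact Finset.sum_congr rfl fun i _ =>
      inner_smul_right (𝕜 := ℂ) (E := A ⊗[ℂ] B) _ _ _

/-- The operator `(1_A ⊗ ⟨χ|) Z (1_A ⊗ |χ⟩)` on `A`, the counterpart of `sandwich`. -/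
def sandwichRight (χ : B) (Z : Op (A ⊗[ℂ] B)) : Op A :=
  let K : A →L[ℂ] A ⊗[ℂ] B := LinearMap.toContinuousLinearMap ((TensorProduct.mk ℂ A B).flip χ)
  ContinuousLinearMap.adjoint K ∘L Z ∘L K

lemma inner_sandwichRight (χ : B) (Z : Op (A ⊗[ℂ] B)) (a a' : A) :
    ⟪a, sandwichRight χ Z a'⟫_ℂ = ⟪a ⊗ₜ[ℂ] χ, Z (a' ⊗ₜ[ℂ] χ)⟫_ℂ := by
  rw [sandwichRight, ContinuousLinearMap.comp_apply, ContinuousLinearMap.comp_apply,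
    ContinuousLinearMap.adjoint_inner_right]
  rfl

lemma inner_sandwich (φ : A) (Z : Op (A ⊗[ℂ] B)) (b b' : B) :
    ⟪b, sandwich φ Z b'⟫_ℂ = ⟪φ ⊗ₜ[ℂ] b, Z (φ ⊗ₜ[ℂ] b')⟫_ℂ := by
  rw [sandwich, ContinuousLinearMap.comp_apply, ContinuousLinearMap.comp_apply,
    ContinuousLinearMap.adjoint_inner_right]
  rfl

lemma quadForm_sandwichRight (χ : B) (Z : Op (A ⊗[ℂ] B)) (a : A) :
    quadForm (sandwichRight χ Z) a = quadForm Z (a ⊗ₜ[ℂ] χ) :=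
  congrArg Complex.re (inner_sandwichRight χ Z a a)

lemma quadForm_sandwich (φ : A) (Z : Op (A ⊗[ℂ] B)) (b : B) :
    quadForm (sandwich φ Z) b = quadForm Z (φ ⊗ₜ[ℂ] b) :=
  congrArg Complex.re (inner_sandwich φ Z b b)

lemma sandwichRight_nonneg (χ : B) {Z : Op (A ⊗[ℂ] B)} (hZ : 0 ≤ Z) : 0 ≤ sandwichRight χ Z :=
  nonneg_of_inner fun v => by
    rw [inner_sandwichRight]
    exact ((ContinuousLinearMap.nonneg_iff_isPositive Z).1 hZ).inner_nonneg_right _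

lemma sandwich_nonneg (φ : A) {Z : Op (A ⊗[ℂ] B)} (hZ : 0 ≤ Z) : 0 ≤ sandwich φ Z :=
  nonneg_of_inner fun v => by
    rw [inner_sandwich]
    exact ((ContinuousLinearMap.nonneg_iff_isPositive Z).1 hZ).inner_nonneg_right _

omit [FiniteDimensional ℂ A] in
lemma opTrace_mul_comm (X Y : Op A) : opTrace (X * Y) = opTrace (Y * X) :=
  LinearMap.trace_mul_comm ℂ X.toLinearMap Y.toLinearMap

omit [FiniteDimensional ℂ A] in
lemma opTrace_eq_sum {ι : Type*} [Fintype ι] (e : OrthonormalBasis ι ℂ A) (X : Op A) :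
    opTrace X = ∑ i, ⟪e i, X (e i)⟫_ℂ :=
  LinearMap.trace_eq_sum_inner _ e

lemma inner_partialMapAB (Z : Op (A ⊗[ℂ] B)) (X : Op A) (χ : B) :
    ⟪χ, partialMapAB Z X χ⟫_ℂ = opTrace (sandwichRight χ Z * X) := by
  rw [opTrace_eq_sum (stdOrthonormalBasis ℂ A)]
  refine (inner_ptraceA (stdOrthonormalBasis ℂ A) _ χ χ).trans (Finset.sum_congr rfl fun i _ => ?_)
  rw [mul_apply_eq_comp, mul_apply_eq_comp, inner_sandwichRight]
  rfl

lemma inner_partialMapBA (Z : Op (A ⊗[ℂ] B)) (Y : Op B) (φ : A) :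
    ⟪φ, partialMapBA Z Y φ⟫_ℂ = opTrace (sandwich φ Z * Y) := by
  rw [opTrace_eq_sum (stdOrthonormalBasis ℂ B)]
  refine (inner_ptraceB (stdOrthonormalBasis ℂ B) _ φ φ).trans (Finset.sum_congr rfl fun i _ => ?_)
  rw [mul_apply_eq_comp, mul_apply_eq_comp, inner_sandwich]
  rfl

omit [FiniteDimensional ℂ A] in
lemma opTrace_nonneg {X : Op A} (hX : 0 ≤ X) : 0 ≤ opTrace X :=
  LinearMap.IsPositive.trace_nonneg ((ContinuousLinearMap.nonneg_iff_isPositive X).1 hX)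

omit [FiniteDimensional ℂ A] in
lemma opTrace_conj (W S : Op A) : opTrace (W * (S * S)) = opTrace (S * W * S) := by
  rw [← mul_assoc, opTrace_mul_comm, mul_assoc]

/-- The value of `tr_A[Z (S² ⊗ 1)]` on a vector `χ` is a sum of values of `Z` on product vectors. -/
lemma quadForm_partialMapAB (Z : Op (A ⊗[ℂ] B)) {S : Op A} (hS : IsSelfAdjoint S) (χ : B) :
    quadForm (partialMapAB Z (S * S)) χ =
      ∑ i, quadForm Z (S (stdOrthonormalBasis ℂ A i) ⊗ₜ[ℂ] χ) := by
  rw [quadForm, inner_partialMapAB, opTrace_conj, opTrace_eq_sum (stdOrthonormalBasis ℂ A),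
    Complex.re_sum]
  refine Finset.sum_congr rfl fun i _ => ?_
  rw [← quadForm_sandwichRight, ← quadForm_conj hS, quadForm]

lemma quadForm_partialMapBA (Z : Op (A ⊗[ℂ] B)) {S : Op B} (hS : IsSelfAdjoint S) (φ : A) :
    quadForm (partialMapBA Z (S * S)) φ =
      ∑ i, quadForm Z (φ ⊗ₜ[ℂ] S (stdOrthonormalBasis ℂ B i)) := by
  rw [quadForm, inner_partialMapBA, opTrace_conj, opTrace_eq_sum (stdOrthonormalBasis ℂ B),
    Complex.re_sum]
  refine Finset.sum_congr rfl fun i _ => ?_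
  rw [← quadForm_sandwich, ← quadForm_conj hS, quadForm]

lemma partialMapAB_nonneg {Z : Op (A ⊗[ℂ] B)} (hZ : 0 ≤ Z) {X : Op A} (hX : 0 ≤ X) :
    0 ≤ partialMapAB Z X := by
  refine nonneg_of_inner fun χ => ?_
  rw [inner_partialMapAB, ← psdPow_mul_self_half hX, opTrace_conj]
  exact opTrace_nonneg (conj_nonneg_of_selfAdjoint (isSelfAdjoint_psdPow _ _)
    (sandwichRight_nonneg χ hZ))

lemma partialMapBA_nonneg {Z : Op (A ⊗[ℂ] B)} (hZ : 0 ≤ Z) {Y : Op B} (hY : 0 ≤ Y) :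
    0 ≤ partialMapBA Z Y := by
  refine nonneg_of_inner fun φ => ?_
  rw [inner_partialMapBA, ← psdPow_mul_self_half hY, opTrace_conj]
  exact opTrace_nonneg (conj_nonneg_of_selfAdjoint (isSelfAdjoint_psdPow _ _)
    (sandwich_nonneg φ hZ))

lemma partialMapAB_apply_eq_zero_iff {Z : Op (A ⊗[ℂ] B)} (hZ : 0 ≤ Z) {S : Op A}
    (hS : IsSelfAdjoint S) (b : B) :
    partialMapAB Z (S * S) b = 0 ↔ ∀ a, Z (S a ⊗ₜ[ℂ] b) = 0 := by
  have h0 : 0 ≤ S * S := by simpa using conj_nonneg_of_selfAdjoint hS (zero_le_one (α := Op A))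
  rw [← quadForm_eq_zero_iff (partialMapAB_nonneg hZ h0), quadForm_partialMapAB Z hS,
    Finset.sum_eq_zero_iff_of_nonneg fun _ _ => quadForm_nonneg hZ _]
  simp only [Finset.mem_univ, true_imp_iff, quadForm_eq_zero_iff hZ]
  refine ⟨fun h a => ?_, fun h i => h _⟩
  rw [← (stdOrthonormalBasis ℂ A).sum_repr a]
  simp [TensorProduct.sum_tmul, ← TensorProduct.smul_tmul', h]

lemma partialMapBA_apply_eq_zero_iff {Z : Op (A ⊗[ℂ] B)} (hZ : 0 ≤ Z) {S : Op B}
    (hS : IsSelfAdjoint S) (a : A) :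
    partialMapBA Z (S * S) a = 0 ↔ ∀ b, Z (a ⊗ₜ[ℂ] S b) = 0 := by
  have h0 : 0 ≤ S * S := by simpa using conj_nonneg_of_selfAdjoint hS (zero_le_one (α := Op B))
  rw [← quadForm_eq_zero_iff (partialMapBA_nonneg hZ h0), quadForm_partialMapBA Z hS,
    Finset.sum_eq_zero_iff_of_nonneg fun _ _ => quadForm_nonneg hZ _]
  simp only [Finset.mem_univ, true_imp_iff, quadForm_eq_zero_iff hZ]
  refine ⟨fun h b => ?_, fun h i => h _⟩
  rw [← (stdOrthonormalBasis ℂ B).sum_repr b]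
  simp [TensorProduct.tmul_sum, TensorProduct.tmul_smul, h]

lemma opTensor_one_one : opTensor (1 : Op A) (1 : Op B) = 1 := by
  apply ContinuousLinearMap.coe_injective
  exact TensorProduct.map_id

lemma ptraceA_eq (Z : Op (A ⊗[ℂ] B)) : ptraceA Z = partialMapAB Z (1 * 1) := by
  rw [mul_one]
  change _ = ptraceA (Z * opTensor 1 1)
  rw [opTensor_one_one, mul_one]

lemma ptraceB_eq (Z : Op (A ⊗[ℂ] B)) : ptraceB Z = partialMapBA Z (1 * 1) := by
  rw [mul_one]
  change _ = ptraceB (Z * opTensor 1 1)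
  rw [opTensor_one_one, mul_one]

lemma ptraceA_apply_eq_zero_iff {Z : Op (A ⊗[ℂ] B)} (hZ : 0 ≤ Z) (b : B) :
    ptraceA Z b = 0 ↔ ∀ a, Z (a ⊗ₜ[ℂ] b) = 0 := by
  rw [ptraceA_eq, partialMapAB_apply_eq_zero_iff hZ (.one _)]; rfl

lemma ptraceB_apply_eq_zero_iff {Z : Op (A ⊗[ℂ] B)} (hZ : 0 ≤ Z) (a : A) :
    ptraceB Z a = 0 ↔ ∀ b, Z (a ⊗ₜ[ℂ] b) = 0 := by
  rw [ptraceB_eq, partialMapBA_apply_eq_zero_iff hZ (.one _)]; rfl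

lemma psdPow_eq_mul_self {X : Op A} (hX : 0 ≤ X) (p : ℝ) :
    psdPow X p = psdPow X (p / 2) * psdPow X (p / 2) := by
  rw [psdPow_mul hX, add_halves]

/-- The range of a power of `X` and the kernel of `X` together span the space. -/
lemma exists_psdPow_add {X : Op A} (hX : 0 ≤ X) (p : ℝ) (a : A) :
    ∃ c k : A, X k = 0 ∧ a = psdPow X p c + k := by
  refine ⟨psdPow X (-p) a, a - psdPow X 0 a, ?_, ?_⟩
  · rw [map_sub, ← mul_apply_eq_comp, mul_psdPow_zero hX, sub_self]
  · rw [← mul_apply_eq_comp, psdPow_mul hX, add_neg_cancel, add_sub_cancel]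

/-- The operator `tr_A[ρ^p (σ^q ⊗ 1)]` has the kernel of `ρ_B`: both consist of the `b` for which
`ρ` vanishes on all `a ⊗ b`, since vectors `a` of the kernel of `σ` contribute nothing. -/
lemma partialMapAB_psdPow_ker {ρ : Op (A ⊗[ℂ] B)} (hρ : 0 ≤ ρ) {σ : Op A} (hσ : 0 ≤ σ)
    (hker : ∀ a, σ a = 0 → ptraceB ρ a = 0) (p q : ℝ) (b : B) :
    partialMapAB (psdPow ρ p) (psdPow σ q) b = 0 ↔ ptraceA ρ b = 0 := by
  rw [psdPow_eq_mul_self hσ, partialMapAB_apply_eq_zero_iff (psdPow_nonneg hρ p)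
    (isSelfAdjoint_psdPow _ _), ptraceA_apply_eq_zero_iff hρ]
  simp only [psdPow_apply_eq_zero_iff hρ]
  refine ⟨fun h a => ?_, fun h a => h _⟩
  obtain ⟨c, k, hk, rfl⟩ := exists_psdPow_add hσ (q / 2) a
  rw [TensorProduct.add_tmul, map_add, h, zero_add]
  exact (ptraceB_apply_eq_zero_iff hρ k).1 (hker k hk) b

lemma partialMapBA_psdPow_ker {ρ : Op (A ⊗[ℂ] B)} (hρ : 0 ≤ ρ) {τ : Op B} (hτ : 0 ≤ τ)
    (hker : ∀ b, τ b = 0 → ptraceA ρ b = 0) (p q : ℝ) (a : A) :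
    partialMapBA (psdPow ρ p) (psdPow τ q) a = 0 ↔ ptraceB ρ a = 0 := by
  rw [psdPow_eq_mul_self hτ, partialMapBA_apply_eq_zero_iff (psdPow_nonneg hρ p)
    (isSelfAdjoint_psdPow _ _), ptraceB_apply_eq_zero_iff hρ]
  simp only [psdPow_apply_eq_zero_iff hρ]
  refine ⟨fun h b => ?_, fun h b => h _⟩
  obtain ⟨c, k, hk, rfl⟩ := exists_psdPow_add hτ (q / 2) b
  rw [TensorProduct.tmul_add, map_add, h, zero_add]
  exact (ptraceA_apply_eq_zero_iff hρ k).1 (hker k hk) a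

/-- A cross ratio bound on product vectors extends from vectors of `A` to positive operators, being
linear in each of the two operators. -/
lemma partialMapAB_cross {Z : Op (A ⊗[ℂ] B)} {D : ℝ}
    (hD : ∀ (φ ψ : A) (χ ω : B), quadForm Z (φ ⊗ₜ[ℂ] χ) * quadForm Z (ψ ⊗ₜ[ℂ] ω) ≤
      D * (quadForm Z (φ ⊗ₜ[ℂ] ω) * quadForm Z (ψ ⊗ₜ[ℂ] χ)))
    {U V : Op A} (hU : 0 ≤ U) (hV : 0 ≤ V) (χ ω : B) :
    quadForm (partialMapAB Z U) χ * quadForm (partialMapAB Z V) ω ≤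
      D * (quadForm (partialMapAB Z U) ω * quadForm (partialMapAB Z V) χ) := by
  rw [← psdPow_mul_self_half hU, ← psdPow_mul_self_half hV]
  simp only [quadForm_partialMapAB Z (isSelfAdjoint_psdPow _ _), Finset.sum_mul_sum]
  simp only [Finset.mul_sum]
  exact Finset.sum_le_sum fun i _ => Finset.sum_le_sum fun j _ => hD _ _ _ _

lemma partialMapBA_cross {Z : Op (A ⊗[ℂ] B)} {D : ℝ}
    (hD : ∀ (φ ψ : A) (χ ω : B), quadForm Z (φ ⊗ₜ[ℂ] χ) * quadForm Z (ψ ⊗ₜ[ℂ] ω) ≤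
      D * (quadForm Z (φ ⊗ₜ[ℂ] ω) * quadForm Z (ψ ⊗ₜ[ℂ] χ)))
    {U V : Op B} (hU : 0 ≤ U) (hV : 0 ≤ V) (φ ψ : A) :
    quadForm (partialMapBA Z U) φ * quadForm (partialMapBA Z V) ψ ≤
      D * (quadForm (partialMapBA Z U) ψ * quadForm (partialMapBA Z V) φ) := by
  rw [← psdPow_mul_self_half hU, ← psdPow_mul_self_half hV]
  simp only [quadForm_partialMapBA Z (isSelfAdjoint_psdPow _ _), Finset.sum_mul_sum]
  simp only [Finset.mul_sum]
  refine Finset.sum_le_sum fun i _ => Finset.sum_le_sum fun j _ =>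
    (hD _ _ _ _).trans_eq (by rw [mul_comm (quadForm Z (φ ⊗ₜ[ℂ] _))])

end PartialTrace

/-! ### Supports, roots and normalization -/

section Normalization

variable {A B : Type*} [NormedAddCommGroup A] [InnerProductSpace ℂ A] [FiniteDimensional ℂ A]
  [NormedAddCommGroup B] [InnerProductSpace ℂ B] [FiniteDimensional ℂ B]

open scoped ComplexOrder in
lemma exists_opTrace_eq {X : Op A} (hX : 0 ≤ X) (hX0 : X ≠ 0) : ∃ t : ℝ, 0 < t ∧ opTrace X = t := by
  have h := Complex.nonneg_iff.1 (opTrace_nonneg hX)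
  refine ⟨(opTrace X).re, h.1.lt_of_ne' fun h0 => hX0 ?_, Complex.ext rfl h.2.symm⟩
  rw [opTrace_eq_sum (stdOrthonormalBasis ℂ A), Complex.re_sum] at h0
  change ∑ i, quadForm X (stdOrthonormalBasis ℂ A i) = 0 at h0
  rw [Finset.sum_eq_zero_iff_of_nonneg fun i _ => quadForm_nonneg hX _] at h0
  refine ContinuousLinearMap.ext fun v => ?_
  rw [← (stdOrthonormalBasis ℂ A).sum_repr v, map_sum]
  refine Finset.sum_eq_zero fun i hi => ?_
  rw [map_smul, (quadForm_eq_zero_iff hX _).1 (h0 i hi), smul_zero]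

lemma exists_normalizeTr_eq {X : Op A} (hX : 0 ≤ X) (hX0 : X ≠ 0) :
    ∃ t : ℝ, 0 < t ∧ normalizeTr X = t • X ∧ opTrace (normalizeTr X) = 1 := by
  obtain ⟨t, ht, h⟩ := exists_opTrace_eq hX hX0
  refine ⟨t⁻¹, inv_pos.2 ht, ?_, ?_⟩
  · rw [normalizeTr, h, ← Complex.ofReal_inv]
    exact Complex.coe_smul _ _
  · rw [normalizeTr, opTrace]
    have : ((opTrace X)⁻¹ • X).toLinearMap = (opTrace X)⁻¹ • X.toLinearMap := rfl
    rw [this, map_smul, smul_eq_mul]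
    refine inv_mul_cancel₀ ?_
    rw [h]; exact_mod_cast ht.ne'

lemma opSim_iff {X Y : Op A} : OpSim X Y ↔ ∀ v, X v = 0 ↔ Y v = 0 := by
  have h : OpSim X Y ↔ LinearMap.ker X.toLinearMap = LinearMap.ker Y.toLinearMap :=
    ⟨fun h => by
      rw [← Submodule.orthogonal_orthogonal (LinearMap.ker X.toLinearMap),
        ← Submodule.orthogonal_orthogonal (LinearMap.ker Y.toLinearMap)]
      exact congrArg Submodule.orthogonal h, fun h => congrArg Submodule.orthogonal h⟩
  rw [h, Submodule.ext_iff]; rfl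

lemma nonneg_ne_zero_ker_of_mem_statesSim {X σ : Op A} (hX : X ≠ 0) (hσ : σ ∈ statesSim X) :
    0 ≤ σ ∧ σ ≠ 0 ∧ ∀ v, σ v = 0 ↔ X v = 0 := by
  have hk := opSim_iff.1 hσ.2
  exact ⟨(ContinuousLinearMap.nonneg_iff_isPositive σ).2 hσ.1.1,
    fun h => hX <| ContinuousLinearMap.ext fun v => (hk v).1 (by rw [h]; rfl), hk⟩

lemma psdPow_ne_zero {X : Op A} (hX : 0 ≤ X) (hX0 : X ≠ 0) (p : ℝ) : psdPow X p ≠ 0 :=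
  fun h => hX0 <| ContinuousLinearMap.ext fun v => by
    rw [_root_.zero_apply, ← psdPow_apply_eq_zero_iff hX p, h]; rfl

/-- Taking a root and normalizing the trace yields a state with the same support. -/
lemma normalizeTr_psdPow_mem {X Y : Op A} (hX : 0 ≤ X) (hY0 : Y ≠ 0)
    (hker : ∀ v, X v = 0 ↔ Y v = 0) (p : ℝ) : normalizeTr (psdPow X p) ∈ statesSim Y := by
  have hX0 : X ≠ 0 := fun h => hY0 <| ContinuousLinearMap.ext fun v => (hker v).1 (by simp [h])
  obtain ⟨t, ht, h1, h2⟩ := exists_normalizeTr_eq (psdPow_nonneg hX p) (psdPow_ne_zero hX hX0 p)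
  refine ⟨⟨?_, h2⟩, opSim_iff.2 fun v => ?_⟩
  · rw [← ContinuousLinearMap.nonneg_iff_isPositive, h1]
    exact smul_nonneg ht.le (psdPow_nonneg hX p)
  · rw [← hker, ← psdPow_apply_eq_zero_iff hX p, h1, _root_.smul_apply,
      smul_eq_zero_iff_right ht.ne']

/-- Taking the `α`-th root divides the metric by `α`, and the normalization does not change it. -/
lemma dH_normalizeTr_psdPow_le {X Y : Op A} (hX : 0 ≤ X) (hX0 : X ≠ 0) (hY : 0 ≤ Y) (hY0 : Y ≠ 0)
    {p q r : ℝ} (hp : 0 < p) (hq : 0 < q) (hr0 : 0 < r) (hr1 : r ≤ 1) (h : X ≤ p • Y)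
    (h' : Y ≤ q • X) : dH (normalizeTr (psdPow X r)) (normalizeTr (psdPow Y r)) ≤
      ((r * Real.log (p * q) : ℝ) : EReal) := by
  obtain ⟨s, hs, e, -⟩ := exists_normalizeTr_eq (psdPow_nonneg hX r) (psdPow_ne_zero hX hX0 r)
  obtain ⟨t, ht, e', -⟩ := exists_normalizeTr_eq (psdPow_nonneg hY r) (psdPow_ne_zero hY hY0 r)
  have key : ∀ {Z W : Op A} {c s t : ℝ}, 0 ≤ Z → 0 ≤ W → 0 < c → 0 < s → 0 < t → Z ≤ c • W →
      s • psdPow Z r ≤ (s * c ^ r / t) • (t • psdPow W r) := by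
    intro Z W c s t hZ hW hc hs ht h
    rw [smul_smul, div_mul_cancel₀ _ ht.ne', mul_smul]
    exact smul_le_smul_of_nonneg_left (psdPow_le_smul hZ hW hc hr0 hr1 h) hs.le
  rw [e, e']
  refine (dH_le_log (smul_nonneg hs.le (psdPow_nonneg hX r))
    (smul_ne_zero hs.ne' (psdPow_ne_zero hX hX0 r)) (smul_nonneg ht.le (psdPow_nonneg hY r))
    (smul_ne_zero ht.ne' (psdPow_ne_zero hY hY0 r)) (key hX hY hp hs ht h)
    (key hY hX hq ht hs h')).trans_eq ?_
  rw [← Real.log_rpow (mul_pos hp hq), Real.mul_rpow hp.le hq.le]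
  congr 2
  field_simp

end Normalization

/-! ### Contraction by powers and positive maps -/

section Contraction

variable {A B : Type*} [NormedAddCommGroup A] [InnerProductSpace ℂ A] [FiniteDimensional ℂ A]
  [NormedAddCommGroup B] [InnerProductSpace ℂ B] [FiniteDimensional ℂ B]

/-- A positive linear map preserves domination constants. Composed with the powers `1 - α` and
`1 / α`, it contracts Hilbert's metric by the factor `(α - 1) / α`. -/
lemma dH_root_map_power_le (T : Op A →ₗ[ℝ] Op B) (hT : ∀ X, 0 ≤ X → 0 ≤ T X) {α : ℝ}
    (hα : α ∈ Set.Ioc (1 : ℝ) 2) {σ σ' : Op A} (hσ : 0 ≤ σ) (hσ' : 0 ≤ σ') (hσ0 : σ ≠ 0)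
    (hσ0' : σ' ≠ 0) (hker : ∀ v, σ v = 0 ↔ σ' v = 0) (hTσ : T (psdPow σ (1 - α)) ≠ 0)
    (hTσ' : T (psdPow σ' (1 - α)) ≠ 0) :
    dH (normalizeTr (psdPow (T (psdPow σ (1 - α))) (1 / α)))
      (normalizeTr (psdPow (T (psdPow σ' (1 - α))) (1 / α))) ≤
      ((1 - 1 / α : ℝ) : EReal) * dH σ σ' := by
  obtain ⟨b, a, hb, ha, hl, hl', hd⟩ := exists_dH_eq_log hσ hσ0 hσ' hσ0' hker
  have key : ∀ {X Y : Op A} {c : ℝ}, X ≤ c • Y → T X ≤ c • T Y := by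
    intro X Y c h
    have := hT _ (sub_nonneg.2 h)
    rwa [map_sub, map_smul, sub_nonneg] at this
  have hα' := hα
  obtain ⟨h1, h2⟩ := hα'
  refine (dH_normalizeTr_psdPow_le (hT _ (psdPow_nonneg hσ _)) hTσ (hT _ (psdPow_nonneg hσ' _)) hTσ'
    (Real.rpow_pos_of_pos ha _) (Real.rpow_pos_of_pos hb _) (by positivity : 0 < 1 / α)
    (by rw [div_le_one (by linarith)]; linarith)
    (key (psdPow_one_sub_le hα hσ' hσ (fun v => (hker v).symm) ha hl'))
    (key (psdPow_one_sub_le hα hσ hσ' hker hb hl))).trans_eq ?_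
  rw [hd, ← EReal.coe_mul, ← Real.mul_rpow ha.le hb.le, Real.log_rpow (mul_pos ha hb), mul_comm a]
  congr 1
  field_simp

/-- Birkhoff's contraction theorem: if the cross ratios of the values of a positive linear map `T`
are bounded by `D`, then `T` contracts Hilbert's metric by the factor `tanh (log D / 4)`. -/
lemma exists_le_smul_of_birkhoff (T : Op A →ₗ[ℝ] Op B) (hT : ∀ X, 0 ≤ X → 0 ≤ T X) {D : ℝ}
    (hD : 1 ≤ D) (hcross : ∀ U V, 0 ≤ U → 0 ≤ V → ∀ χ ω,
      quadForm (T U) χ * quadForm (T V) ω ≤ D * (quadForm (T U) ω * quadForm (T V) χ))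
    {X Y : Op A} (hX : 0 ≤ X) (hX0 : X ≠ 0) (hY : 0 ≤ Y) (hTX : T X ≠ 0) (hTY : T Y ≠ 0) {p q : ℝ}
    (hp : 0 < p) (hq : 0 < q) (h : X ≤ p • Y) (h' : Y ≤ q • X) :
    ∃ p' q' : ℝ, 0 < p' ∧ 0 < q' ∧ T X ≤ p' • T Y ∧ T Y ≤ q' • T X ∧
      Real.log (p' * q') ≤ Real.tanh (Real.log D / 4) * Real.log (p * q) := by
  have hpq := one_le_mul_of_le_smul hX hX0 hY h h'
  have t1 := hT _ (sub_nonneg.2 h)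
  have t2 := hT _ (sub_nonneg.2 h')
  have hc := hcross _ _ (sub_nonneg.2 h) (sub_nonneg.2 h')
  rw [map_sub, map_smul] at t1 t2
  simp only [map_sub, map_smul, quadForm_sub, quadForm_smul] at hc
  have n1 : ∀ v, 0 ≤ p * quadForm (T Y) v - quadForm (T X) v := fun v => by
    simpa using quadForm_nonneg t1 v
  have n2 : ∀ v, 0 ≤ q * quadForm (T X) v - quadForm (T Y) v := fun v => by
    simpa using quadForm_nonneg t2 v
  obtain ⟨p', q', hp', hq', l, l', hle⟩ := exists_le_smul_of_cross (hT X hX) hTX (hT Y hY) hTY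
    (sub_nonneg.1 t1) (sub_nonneg.1 t2) fun v w =>
      birkhoff_cross hp hq hD hpq (quadForm_nonneg (hT X hX) v) (quadForm_nonneg (hT Y hY) w)
        (n1 v) (n2 v) (n1 w) (n2 w) (by linarith [hc w v])
  exact ⟨p', q', hp', hq', l, l', (Real.log_le_log (mul_pos hp' hq') hle).trans
    (log_birkhoff_le hpq hD)⟩

/-- Composed with the powers `1 - α` and `1 / α`, the map `T` contracts by `(α - 1) / α` times its
ratio from Birkhoff's theorem. -/
lemma dH_root_map_power_le_tanh (T : Op A →ₗ[ℝ] Op B) (hT : ∀ X, 0 ≤ X → 0 ≤ T X) {D : ℝ}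
    (hD : 1 ≤ D) (hcross : ∀ U V, 0 ≤ U → 0 ≤ V → ∀ χ ω,
      quadForm (T U) χ * quadForm (T V) ω ≤ D * (quadForm (T U) ω * quadForm (T V) χ))
    {α : ℝ} (hα : α ∈ Set.Ioc (1 : ℝ) 2) {σ σ' : Op A} (hσ : 0 ≤ σ) (hσ' : 0 ≤ σ') (hσ0 : σ ≠ 0)
    (hσ0' : σ' ≠ 0) (hker : ∀ v, σ v = 0 ↔ σ' v = 0) (hTσ : T (psdPow σ (1 - α)) ≠ 0)
    (hTσ' : T (psdPow σ' (1 - α)) ≠ 0) :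
    dH (normalizeTr (psdPow (T (psdPow σ (1 - α))) (1 / α)))
      (normalizeTr (psdPow (T (psdPow σ' (1 - α))) (1 / α))) ≤
      (((1 - 1 / α) * Real.tanh (Real.log D / 4) : ℝ) : EReal) * dH σ σ' := by
  obtain ⟨b, a, hb, ha, hl, hl', hd⟩ := exists_dH_eq_log hσ hσ0 hσ' hσ0' hker
  obtain ⟨p, q, hp, hq, l, l', hle⟩ := exists_le_smul_of_birkhoff T hT hD hcross
    (psdPow_nonneg hσ (1 - α)) (psdPow_ne_zero hσ hσ0 _) (psdPow_nonneg hσ' (1 - α)) hTσ hTσ'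
    (Real.rpow_pos_of_pos ha _) (Real.rpow_pos_of_pos hb _)
    (psdPow_one_sub_le hα hσ' hσ (fun v => (hker v).symm) ha hl')
    (psdPow_one_sub_le hα hσ hσ' hker hb hl)
  obtain ⟨h1, h2⟩ := hα
  refine (dH_normalizeTr_psdPow_le (hT _ (psdPow_nonneg hσ _)) hTσ (hT _ (psdPow_nonneg hσ' _)) hTσ'
    hp hq (by positivity : 0 < 1 / α) (by rw [div_le_one (by linarith)]; linarith) l l').trans ?_
  rw [hd, ← EReal.coe_mul, EReal.coe_le_coe_iff]
  rw [← Real.mul_rpow ha.le hb.le, Real.log_rpow (mul_pos ha hb), mul_comm a] at hle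
  refine (mul_le_mul_of_nonneg_left hle (by positivity)).trans_eq ?_
  field_simp

end Contraction

/-! ### The projective diameter -/

section Diameter

variable {A B : Type*} [NormedAddCommGroup A] [InnerProductSpace ℂ A] [FiniteDimensional ℂ A]
  [NormedAddCommGroup B] [InnerProductSpace ℂ B] [FiniteDimensional ℂ B]

omit [FiniteDimensional ℂ A] in
lemma continuous_quadForm (X : Op A) : Continuous (quadForm X) := by
  unfold quadForm
  fun_prop

lemma exists_unit_smul {E : Type*} [NormedAddCommGroup E] [InnerProductSpace ℂ E] [Nontrivial E]
    (v : E) : ∃ e : E, ‖e‖ = 1 ∧ v = (‖v‖ : ℂ) • e := by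
  by_cases hv : v = 0
  · obtain ⟨e, he⟩ := exists_norm_eq E (zero_le_one (α := ℝ))
    exact ⟨e, he, by simp [hv]⟩
  · have hv' : (‖v‖ : ℂ) ≠ 0 := by simpa using hv
    refine ⟨(‖v‖ : ℂ)⁻¹ • v, ?_, (smul_inv_smul₀ hv' v).symm⟩
    rw [norm_smul, norm_inv, Complex.norm_real, norm_norm, inv_mul_cancel₀ (by simpa using hv)]

/-- The cross ratios of a positive definite operator on unit product vectors have a maximum. -/
lemma exists_max_cross [Nontrivial A] [Nontrivial B] {Z : Op (A ⊗[ℂ] B)}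
    (hZ : ∀ v, v ≠ 0 → 0 < quadForm Z v) :
    ∃ (D : ℝ) (φ ψ : A) (χ ω : B), ‖φ‖ = 1 ∧ ‖ψ‖ = 1 ∧ ‖χ‖ = 1 ∧ ‖ω‖ = 1 ∧
      quadForm Z (φ ⊗ₜ[ℂ] χ) * quadForm Z (ψ ⊗ₜ[ℂ] ω) =
        D * (quadForm Z (φ ⊗ₜ[ℂ] ω) * quadForm Z (ψ ⊗ₜ[ℂ] χ)) ∧
      ∀ (φ ψ : A) (χ ω : B), quadForm Z (φ ⊗ₜ[ℂ] χ) * quadForm Z (ψ ⊗ₜ[ℂ] ω) ≤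
        D * (quadForm Z (φ ⊗ₜ[ℂ] ω) * quadForm Z (ψ ⊗ₜ[ℂ] χ)) := by
  have hpos : ∀ {a : A} {b : B}, ‖a‖ = 1 → ‖b‖ = 1 → 0 < quadForm Z (a ⊗ₜ[ℂ] b) := by
    intro a b ha hb
    refine hZ _ (norm_ne_zero_iff.1 ?_)
    rw [TensorProduct.norm_tmul, ha, hb]; norm_num
  set K : Set ((A × A) × (B × B)) := (Metric.sphere 0 1 ×ˢ Metric.sphere 0 1) ×ˢ
    (Metric.sphere 0 1 ×ˢ Metric.sphere 0 1) with hK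
  have : ProperSpace A := FiniteDimensional.proper ℂ A
  have : ProperSpace B := FiniteDimensional.proper ℂ B
  have hKc : IsCompact K := ((isCompact_sphere _ _).prod (isCompact_sphere _ _)).prod
    ((isCompact_sphere _ _).prod (isCompact_sphere _ _))
  have hKm : ∀ {z : (A × A) × (B × B)}, z ∈ K ↔
      (‖z.1.1‖ = 1 ∧ ‖z.1.2‖ = 1) ∧ (‖z.2.1‖ = 1 ∧ ‖z.2.2‖ = 1) := by
    intro z; simp [hK, Set.mem_prod]
  obtain ⟨a, ha⟩ := exists_norm_eq A (zero_le_one (α := ℝ))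
  obtain ⟨b, hb⟩ := exists_norm_eq B (zero_le_one (α := ℝ))
  have hKn : K.Nonempty := ⟨((a, a), (b, b)), hKm.2 ⟨⟨ha, ha⟩, hb, hb⟩⟩
  let f : A → B → ℝ := fun a b => quadForm Z (a ⊗ₜ[ℂ] b)
  have hf : Continuous fun x : A × B => f x.1 x.2 :=
    (continuous_quadForm Z).comp TensorProduct.continuous_tmul
  let g : (A × A) × (B × B) → ℝ := fun z =>
    (f z.1.1 z.2.1 * f z.1.2 z.2.2) / (f z.1.1 z.2.2 * f z.1.2 z.2.1)
  have hg : ContinuousOn g K := by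
    have c : ∀ {u : (A × A) × (B × B) → A} {v : (A × A) × (B × B) → B}, Continuous u →
      Continuous v → ContinuousOn (fun z => f (u z) (v z)) K := fun hu hv =>
        (hf.comp (hu.prodMk hv)).continuousOn
    refine ((c (by fun_prop) (by fun_prop)).mul (c (by fun_prop) (by fun_prop))).div
      ((c (by fun_prop) (by fun_prop)).mul (c (by fun_prop) (by fun_prop))) fun z hz => ?_
    obtain ⟨⟨z1, z2⟩, z3, z4⟩ := hKm.1 hz
    exact (mul_pos (hpos z1 z4) (hpos z2 z3)).ne'
  obtain ⟨z, hz, hmax⟩ := hKc.exists_isMaxOn hKn hg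
  obtain ⟨⟨z1, z2⟩, z3, z4⟩ := hKm.1 hz
  refine ⟨g z, z.1.1, z.1.2, z.2.1, z.2.2, z1, z2, z3, z4,
    (div_mul_cancel₀ _ (mul_pos (hpos z1 z4) (hpos z2 z3)).ne').symm, ?_⟩
  have hunit : ∀ (φ ψ : A) (χ ω : B), ‖φ‖ = 1 → ‖ψ‖ = 1 → ‖χ‖ = 1 → ‖ω‖ = 1 →
      f φ χ * f ψ ω ≤ g z * (f φ ω * f ψ χ) := by
    intro φ ψ χ ω h1 h2 h3 h4
    have : g ((φ, ψ), (χ, ω)) ≤ g z := hmax (hKm.2 ⟨⟨h1, h2⟩, h3, h4⟩)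
    rwa [div_le_iff₀ (mul_pos (hpos h1 h4) (hpos h2 h3))] at this
  -- The inequality is homogeneous in each of the four vectors.
  intro φ ψ χ ω
  obtain ⟨φ', h1, e1⟩ := exists_unit_smul φ
  obtain ⟨ψ', h2, e2⟩ := exists_unit_smul ψ
  obtain ⟨χ', h3, e3⟩ := exists_unit_smul χ
  obtain ⟨ω', h4, e4⟩ := exists_unit_smul ω
  have hs : ∀ (c d : ℂ) (a : A) (b : B),
      quadForm Z ((c • a) ⊗ₜ[ℂ] (d • b)) = (‖c‖ ^ 2 * ‖d‖ ^ 2) * f a b := by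
    intro c d a b
    rw [← TensorProduct.smul_tmul', TensorProduct.tmul_smul, quadForm_smul_vec, quadForm_smul_vec,
      mul_assoc]
  rw [e1, e2, e3, e4]
  simp only [hs]
  have := mul_le_mul_of_nonneg_left (hunit φ' ψ' χ' ω' h1 h2 h3 h4)
    (by positivity : 0 ≤ (‖(‖φ‖ : ℂ)‖ ^ 2 * ‖(‖χ‖ : ℂ)‖ ^ 2) * (‖(‖ψ‖ : ℂ)‖ ^ 2 * ‖(‖ω‖ : ℂ)‖ ^ 2))
  linarith

/-- The maximum of the norms defining the projective diameter is that of the cross ratios on product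
vectors, hence symmetric in the two tensor factors. -/
lemma exists_isGreatest_diamSet [Nontrivial A] [Nontrivial B] (α : ℝ) {ρ : Op (A ⊗[ℂ] B)}
    (hZ0 : 0 ≤ psdPow ρ α) (hZ : ∀ v, v ≠ 0 → 0 < quadForm (psdPow ρ α) v) :
    ∃ D : ℝ, 1 ≤ D ∧ IsGreatest (diamSet α ρ) D ∧
      ∀ (φ ψ : A) (χ ω : B),
        quadForm (psdPow ρ α) (φ ⊗ₜ[ℂ] χ) * quadForm (psdPow ρ α) (ψ ⊗ₜ[ℂ] ω) ≤
        D * (quadForm (psdPow ρ α) (φ ⊗ₜ[ℂ] ω) * quadForm (psdPow ρ α) (ψ ⊗ₜ[ℂ] χ)) := by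
  obtain ⟨D, φ, ψ, χ, ω, h1, h2, h3, h4, hmax, hD⟩ := exists_max_cross hZ
  set Z := psdPow ρ α with hZdef
  have hpos : ∀ {a : A} {b : B}, ‖a‖ = 1 → b ≠ 0 → 0 < quadForm Z (a ⊗ₜ[ℂ] b) := by
    intro a b ha hb
    refine hZ _ (norm_ne_zero_iff.1 ?_)
    rw [TensorProduct.norm_tmul, ha, one_mul]; exact norm_ne_zero_iff.2 hb
  have hne : ∀ {b : B}, ‖b‖ = 1 → b ≠ 0 := fun hb =>
    norm_ne_zero_iff.1 (by rw [hb]; exact one_ne_zero)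
  have hker : ∀ {a : A}, ‖a‖ = 1 → ∀ b, sandwich a Z b = 0 → b = 0 := by
    intro a ha b hb
    by_contra hb0
    have := hpos ha hb0
    rw [← quadForm_sandwich, (quadForm_eq_zero_iff (sandwich_nonneg a hZ0) b).2 hb] at this
    exact lt_irrefl _ this
  have hle : ∀ {a a' : A}, ‖a‖ = 1 → ‖a'‖ = 1 →
      sandwich a Z ≤ ratioNorm (sandwich a Z) (sandwich a' Z) • sandwich a' Z := fun ha ha' =>
    le_ratioNorm_smul (sandwich_nonneg _ hZ0) (sandwich_nonneg _ hZ0) fun v hv => by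
      rw [hker ha' v hv, map_zero]
  have hne0 : ∀ {a : A}, ‖a‖ = 1 → sandwich a Z ≠ 0 := by
    intro a ha h
    have := hker ha χ (by rw [h]; rfl)
    exact hne h3 this
  have hub : ∀ {a a' : A}, ‖a‖ = 1 → ‖a'‖ = 1 →
      ratioNorm (sandwich a' Z) (sandwich a Z) * ratioNorm (sandwich a Z) (sandwich a' Z) ≤ D := by
    intro a a' ha ha'
    obtain ⟨p, q, hp, hq, l, l', hpq⟩ := exists_le_smul_of_cross (sandwich_nonneg a' hZ0) (hne0 ha')
      (sandwich_nonneg a hZ0) (hne0 ha) (hle ha' ha) (hle ha ha') (K := D) fun v w => by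
        simp only [quadForm_sandwich]
        rw [mul_comm (quadForm Z (a ⊗ₜ[ℂ] v))]
        exact hD a' a v w
    exact (mul_le_mul (ratioNorm_le (sandwich_nonneg _ hZ0) (sandwich_nonneg _ hZ0) hp.le l)
      (ratioNorm_le (sandwich_nonneg _ hZ0) (sandwich_nonneg _ hZ0) hq.le l')
      (ratioNorm_nonneg _ _) hp.le).trans hpq
  refine ⟨D, ?_, ⟨⟨ψ, φ, h2, h1, le_antisymm ?_ (hub h2 h1)⟩, ?_⟩, hD⟩
  · have := hD φ φ χ χ
    have h5 := hpos h1 (hne h3)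
    exact le_of_mul_le_mul_right (by linarith) (mul_pos h5 h5)
  · have e1 := quadForm_le (hle h1 h2) χ
    have e2 := quadForm_le (hle h2 h1) ω
    rw [quadForm_smul] at e1 e2
    simp only [quadForm_sandwich] at e1 e2
    have e3 := mul_le_mul e1 e2 (hpos h2 (hne h4)).le
      (mul_nonneg (ratioNorm_nonneg _ _) (hpos h2 (hne h3)).le)
    rw [hmax] at e3
    refine le_of_mul_le_mul_right (e3.trans_eq ?_) (mul_pos (hpos h1 (hne h4)) (hpos h2 (hne h3)))
    ring
  · rintro r ⟨a, a', ha, ha', rfl⟩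
    exact hub ha ha'

end Diameter

/-! ### Contraction of the alternating minimization maps -/

theorem theorem1 {A B : Type*}
    [NormedAddCommGroup A] [InnerProductSpace ℂ A] [FiniteDimensional ℂ A]
    [NormedAddCommGroup B] [InnerProductSpace ℂ B] [FiniteDimensional ℂ B]
    (α : ℝ) (hα : α ∈ Set.Ioc (1 : ℝ) 2)
    (ρ : Op (A ⊗[ℂ] B)) (hρ : ρ ∈ states (A ⊗[ℂ] B))
    (γ : ℝ) (hγ : γ = |1 - 1 / α|) :
    -- the maps are well defined between the sets of states in question
    (Set.MapsTo (mapAB α ρ) (statesAbove (ptraceB ρ)) (statesSim (ptraceA ρ)) ∧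
      Set.MapsTo (mapBA α ρ) (statesAbove (ptraceA ρ)) (statesSim (ptraceB ρ))) ∧
    -- part (a)
    ((∀ σ ∈ statesSim (ptraceB ρ), ∀ σ' ∈ statesSim (ptraceB ρ),
        dH (mapAB α ρ σ) (mapAB α ρ σ') ≤ (γ : EReal) * dH σ σ') ∧
      (∀ τ ∈ statesSim (ptraceA ρ), ∀ τ' ∈ statesSim (ptraceA ρ),
        dH (mapBA α ρ τ) (mapBA α ρ τ') ≤ (γ : EReal) * dH τ τ')) ∧
    -- part (b)
    (IsPosDefOp ρ →
      IsGreatest (diamSet α ρ) (sSup (diamSet α ρ)) ∧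
      ∀ κ : ℝ, κ = Real.tanh (projDiam α ρ / 4) →
        κ ∈ Set.Ico (0 : ℝ) 1 ∧
        (∀ σ ∈ statesSim (ptraceB ρ), ∀ σ' ∈ statesSim (ptraceB ρ),
          dH (mapAB α ρ σ) (mapAB α ρ σ') ≤ ((γ * κ : ℝ) : EReal) * dH σ σ') ∧
        (∀ τ ∈ statesSim (ptraceA ρ), ∀ τ' ∈ statesSim (ptraceA ρ),
          dH (mapBA α ρ τ) (mapBA α ρ τ') ≤ ((γ * κ : ℝ) : EReal) * dH τ τ')) := by
  have hρ0 : 0 ≤ ρ := (ContinuousLinearMap.nonneg_iff_isPositive ρ).2 hρ.1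
  have hZ0 : 0 ≤ psdPow ρ α := psdPow_nonneg hρ0 α
  have hρne : ρ ≠ 0 := by
    rintro rfl
    have h := hρ.2
    simp [opTrace] at h
  have hext : (∀ (a : A) (b : B), ρ (a ⊗ₜ[ℂ] b) = 0) → False := fun h =>
    hρne <| ContinuousLinearMap.coe_injective <| TensorProduct.ext' fun a b => h a b
  have hA0 : ptraceA ρ ≠ 0 := fun h => hext fun a b =>
    (ptraceA_apply_eq_zero_iff hρ0 b).1 (by rw [h]; rfl) a
  have hB0 : ptraceB ρ ≠ 0 := fun h => hext fun a b =>
    (ptraceB_apply_eq_zero_iff hρ0 a).1 (by rw [h]; rfl) b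
  have hγ' : γ = 1 - 1 / α := by
    rw [hγ, abs_of_nonneg]
    rw [sub_nonneg, div_le_one (by linarith [hα.1])]
    exact hα.1.le
  have hpA : ∀ X : Op A, 0 ≤ X → 0 ≤ partialMapAB (psdPow ρ α) X := fun X => partialMapAB_nonneg hZ0
  have hpB : ∀ Y : Op B, 0 ≤ Y → 0 ≤ partialMapBA (psdPow ρ α) Y := fun X => partialMapBA_nonneg hZ0
  have hTA : ∀ {σ : Op A}, 0 ≤ σ → (∀ v, σ v = 0 ↔ ptraceB ρ v = 0) →
      partialMapAB (psdPow ρ α) (psdPow σ (1 - α)) ≠ 0 := fun hσ hk h =>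
    hA0 <| ContinuousLinearMap.ext fun b =>
      (partialMapAB_psdPow_ker hρ0 hσ (fun a => (hk a).1) α (1 - α) b).1 (by rw [h]; rfl)
  have hTB : ∀ {τ : Op B}, 0 ≤ τ → (∀ v, τ v = 0 ↔ ptraceA ρ v = 0) →
      partialMapBA (psdPow ρ α) (psdPow τ (1 - α)) ≠ 0 := fun hτ hk h =>
    hB0 <| ContinuousLinearMap.ext fun a =>
      (partialMapBA_psdPow_ker hρ0 hτ (fun b => (hk b).1) α (1 - α) a).1 (by rw [h]; rfl)
  refine ⟨⟨fun σ hσ => ?_, fun τ hτ => ?_⟩, ⟨fun σ hσ σ' hσ' => ?_, fun τ hτ τ' hτ' => ?_⟩,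
    fun hpd => ?_⟩
  · have hσ0 : 0 ≤ σ := (ContinuousLinearMap.nonneg_iff_isPositive σ).2 hσ.1.1
    exact normalizeTr_psdPow_mem (hpA _ (psdPow_nonneg hσ0 _)) hA0
      (partialMapAB_psdPow_ker hρ0 hσ0 (fun a ha => hσ.2 ha) α (1 - α)) _
  · have hτ0 : 0 ≤ τ := (ContinuousLinearMap.nonneg_iff_isPositive τ).2 hτ.1.1
    exact normalizeTr_psdPow_mem (hpB _ (psdPow_nonneg hτ0 _)) hB0
      (partialMapBA_psdPow_ker hρ0 hτ0 (fun a ha => hτ.2 ha) α (1 - α)) _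
  · obtain ⟨p1, n1, k1⟩ := nonneg_ne_zero_ker_of_mem_statesSim hB0 hσ
    obtain ⟨p2, n2, k2⟩ := nonneg_ne_zero_ker_of_mem_statesSim hB0 hσ'
    rw [hγ']
    exact dH_root_map_power_le _ hpA hα p1 p2 n1 n2 (fun v => (k1 v).trans (k2 v).symm)
      (hTA p1 k1) (hTA p2 k2)
  · obtain ⟨p1, n1, k1⟩ := nonneg_ne_zero_ker_of_mem_statesSim hA0 hτ
    obtain ⟨p2, n2, k2⟩ := nonneg_ne_zero_ker_of_mem_statesSim hA0 hτ'
    rw [hγ']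
    exact dH_root_map_power_le _ hpB hα p1 p2 n1 n2 (fun v => (k1 v).trans (k2 v).symm)
      (hTB p1 k1) (hTB p2 k2)
  · have : Nontrivial A := by
      by_contra h
      rw [not_nontrivial_iff_subsingleton] at h
      exact hB0 (Subsingleton.elim _ _)
    have : Nontrivial B := by
      by_contra h
      rw [not_nontrivial_iff_subsingleton] at h
      exact hA0 (Subsingleton.elim _ _)
    have hZ : ∀ v, v ≠ 0 → 0 < quadForm (psdPow ρ α) v := fun v hv =>
      (quadForm_nonneg hZ0 v).lt_of_ne' fun h => by
        rw [quadForm_eq_zero_iff hZ0, psdPow_apply_eq_zero_iff hρ0] at h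
        have := hpd.2 v hv
        rw [h, inner_zero_right] at this
        exact lt_irrefl _ this
    obtain ⟨D, hD1, hgr, hD⟩ := exists_isGreatest_diamSet α hZ0 hZ
    rw [projDiam, hgr.csSup_eq]
    refine ⟨hgr, fun κ hκ => ⟨⟨?_, ?_⟩, fun σ hσ σ' hσ' => ?_, fun τ hτ τ' hτ' => ?_⟩⟩
    · rw [hκ, Real.tanh_eq_sinh_div_cosh]
      have := Real.log_nonneg hD1
      exact div_nonneg (Real.sinh_nonneg_iff.2 (by positivity)) (Real.cosh_pos _).le
    · rw [hκ, Real.tanh_eq_sinh_div_cosh, div_lt_one (Real.cosh_pos _)]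
      exact Real.sinh_lt_cosh _
    · obtain ⟨p1, n1, k1⟩ := nonneg_ne_zero_ker_of_mem_statesSim hB0 hσ
      obtain ⟨p2, n2, k2⟩ := nonneg_ne_zero_ker_of_mem_statesSim hB0 hσ'
      rw [hγ', hκ]
      exact dH_root_map_power_le_tanh _ hpA hD1 (fun U V => partialMapAB_cross hD) hα p1 p2 n1 n2
        (fun v => (k1 v).trans (k2 v).symm) (hTA p1 k1) (hTA p2 k2)
    · obtain ⟨p1, n1, k1⟩ := nonneg_ne_zero_ker_of_mem_statesSim hA0 hτ
      obtain ⟨p2, n2, k2⟩ := nonneg_ne_zero_ker_of_mem_statesSim hA0 hτ'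
      rw [hγ', hκ]
      exact dH_root_map_power_le_tanh _ hpB hD1 (fun U V => partialMapBA_cross hD) hα p1 p2 n1 n2
        (fun v => (k1 v).trans (k2 v).symm) (hTB p1 k1) (hTB p2 k2)
end
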